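/- A matrix $[\alpha_{i,j}]$ over $\mathbb{F}_2$ is called persymmetric if $\alpha_{i,j}=\alpha_{r,t}$ whenever $i+j=r+t$. For positive integers $a,b,c,k$ and an integer $i\ge 0$, let $\Gamma_i^{[a,b,c]\times k}$ denote the number of $(a+b+c)\times k$ matrices over $\mathbb{F}_2$ of rank $i$ of the form $\begin{pmatrix}A\\ B\\ C\end{pmatrix}$ with $A$ an $a\times k$, $B$ a $b\times k$ and $C$ a $c\times k$ persymmetric matrix. **Theorem 3.5.** Let $s\ge 1$ be an integer; $i,j,k$ denote integers with $k\ge 1$. (1) The number $\Gamma_i^{[s,s+1,s+1]\times k}$ equals * $1$, if $i=0$; * $105\cdot 2^{4i-6}-21\cdot 2^{3i-5}$, if $1\le i\le s-1$, $k\ge i+1$; * $2^{k+s-1}-2^{2s}+105\cdot 2^{4s-6}-21\cdot 2^{3s-5}$, if $i=s$, $k\ge s+1$; * $33\cdot 2^{k+s-1}+105\cdot 2^{4s-2}-21\cdot 2^{3s-2}-69\cdot 2^{2s}$, if $i=s+1$, $k\ge s+2$; * $630\cdot 2^{k+s-1}+21\,[5\cdot 2^{4s+2}-2^{3s+1}-65\cdot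 2^{2s+1}]$, if $i=s+2$, $s\ge 2$, $k\ge s+3$; * $1365\cdot 2^{k+s+2}+21\,[5\cdot 2^{4s+6}-2^{3s+4}-285\cdot 2^{2s+4}]$, if $i=s+3$, $s\ge 3$, $k\ge s+4$; * $2835\cdot 2^{k+s+5}+21\,[5\cdot 2^{4s+10}-2^{3s+7}-595\cdot 2^{2s+8}]$, if $i=s+4$, $s\ge 4$, $k\ge s+5$; * $105\,(7\cdot 2^{j-2}-1)\,2^{k+s+3j-7}+21\,[5\cdot 2^{4s+4j-6}-2^{3s+3j-5}-155\cdot 2^{2s+5j-10}+25\cdot 2^{2s+4j-8}]$, if $i=s+j$, $2\le j\le s$, $k\ge s+j+1$; * $3\cdot 2^{2s-1}(2^{2k}-2^{4s+4})+(735\cdot 2^{5s-5}-393\cdot 2^{4s-4})(2^k-2^{2s+2})+21\,[5\cdot 2^{8s-2}+2^{6s-4}-15\cdot 2^{7s-5}]$, if $i=2s+1$, $k\ge 2s+2$; * $53\cdot 2^{2s-1}(2^{2k}-2^{4s+6})+(735\cdot 2^{5s-1}-1629\cdot 2^{4s-1})(2^k-2^{2s+3})+21\,[5\cdot 2^{8s+2}+3\cdot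 2^{6s}-15\cdot 2^{7s}]$, if $i=2s+2$, $k\ge 2s+3$; * $105\,(2^{2k+2s+4j+2}+7\cdot 2^{k+5s+4j+3}-31\cdot 2^{k+4s+5j+3})+105\,(2^{8s+4j+6}-31\cdot 2^{7s+5j+5}+93\cdot 2^{6s+6j+5})$, if $i=2s+3+j$, $0\le j\le s-2$, $k\ge 2s+4+j$; * $2^{3k+3s-1}-7\cdot 2^{2k+6s-2}+7\cdot 2^{k+9s-2}-2^{12s-1}$, if $i=3s+2$, $k\ge 3s+2$. (2) The number $\Gamma_i^{[s,s+1,s+1]\times i}$ equals * $2^{3s+3i-1}-7\cdot 2^{4i-6}+3\cdot 2^{3i-5}$, if $1\le i\le s+1$; * $2^{6s+3j-1}-7\cdot 2^{4s+4j-6}+3\cdot 2^{3s+3j-5}+7\cdot 2^{2s+5j-10}-5\cdot 2^{2s+4j-8}$, if $i=s+j$, $2\le j\le s+3$; * $2^{9s+2}+7\cdot 2^{7s-5}-7\cdot 2^{8s-2}+7\cdot 2^{6s-4}$, if $i=2s+1$; * $2^{9s+5}+7\cdot 2^{7s}-7\cdot 2^{8s+2}+2^{6s}$, if $i=2s+2$;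 * $2^{9s+8}+7\cdot 2^{7s+5}-7\cdot 2^{8s+6}-2^{6s+5}$, if $i=2s+3$; * $2^{9s+3j+8}-7\cdot 2^{8s+4j+6}+7\cdot 2^{7s+5j+5}-2^{6s+6j+5}$, if $i=2s+3+j$, $0\le j\le s-1$. (3) The following reduction formulas hold: $$\Gamma_{2s+2+j}^{[s,s+1,s+1]\times k}=16^{2j}\,\Gamma_{2s+2-j}^{[s,\,s+(1-j),\,s+(1-j)]\times (k-2j)}\qquad (0\le j\le 1,\ k\ge 2j+1),$$ $$\Gamma_{2s+3+j}^{[s,s+1,s+1]\times k}=16^{2+3j}\,\Gamma_{2(s-j)+1}^{[s-j,\,s-j,\,s-j]\times (k-2-3j)}\qquad (0\le j\le s-1,\ k\ge 3j+3).$$ -/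

import Mathlib

/-- A matrix is persymmetric if its entries are constant on the antidiagonals:
`A i j = A r t` whenever `i + j = r + t`. -/
def IsPersymmetric {p q : ℕ} (A : Matrix (Fin p) (Fin q) (ZMod 2)) : Prop :=
  ∀ (i r : Fin p) (j t : Fin q), (i : ℕ) + (j : ℕ) = (r : ℕ) + (t : ℕ) → A i j = A r t

/-- `persymCount a b c k i` is the number of triple persymmetric `(a + b + c) × k` matrices over
`𝔽₂` of rank `i`, that is, of matrices of rank `i` obtained by stacking an `a × k`, a `b × k` and
a `c × k` persymmetric matrix. -/
noncomputable def persymCount (a b c k i : ℕ) : ℕ :=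
  Set.ncard {M : Matrix (Fin a) (Fin k) (ZMod 2) × Matrix (Fin b) (Fin k) (ZMod 2) ×
      Matrix (Fin c) (Fin k) (ZMod 2) |
    IsPersymmetric M.1 ∧ IsPersymmetric M.2.1 ∧ IsPersymmetric M.2.2 ∧
      (Matrix.fromRows M.1 (Matrix.fromRows M.2.1 M.2.2)).rank = i}

/-! The three persymmetric blocks are encoded by one sequence `u` in `𝔽₂³` of length `m`. Instead of
a single matrix, the argument follows the nullities of all truncated block Hankel systems of `u` at
once: at level `d` there are `d` block rows and `m + 1 - d` columns. An auxiliary column (`ε = 1`)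
absorbs row `0` of the first block, so that `ε = 0` gives the shape `(s, s, s)` and `ε = 1` the
shape `(s, s + 1, s + 1)` (`nullityAt_add_rank`). The successive differences of the nullities are at
most `4` and weakly decreasing: they form the conjugate partition of a splitting type, of total `m +
1 + ε`.

Appending one term to `u` adds `1` to exactly one part (`splitType_succ`). Which part it is depends
on the solutions with nonzero last coefficient, and the number of continuations that preserve such a
solution is a power of two read off from the parts (`ncard_lastUsed_succ`). Hence the number of
sequences of a given type satisfies a recursion in `m`. It is solved by a product of factors
`stepWeight` over consecutive parts, corrected by a function of the first two parts
(`typeCount_eq`).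

A rank count thus becomes a sum over partitions with the tail sum after a given part prescribed
(`sum_nullityAt_eq`). The weight is a product along a path, so the sum splits at that part. The tail
has the closed form `upperSum`; the head is an iterate of the transfer operator `lowerStep`,
evaluated in closed form by `isLowerClosed_iterate`. These give the explicit formulas.

The reduction formulas compare heads of different lengths. When the sum of a head is close to its
maximum `4 * d`, heads of different lengths have proportional weights (`AgreeAtTop`), with ratio
`4096 = 16 ^ 3` for each extra part `4`. -/

/-! ### Nullities of truncated block Hankel systems. -/

/-- The ambient space of candidate kernel vectors: `N` coefficients and three auxiliary entries. -/
abbrev KerSpace (N : ℕ) : Type := (Fin N → ZMod 2) × (Fin 3 → ZMod 2)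

/-- The `i`-th rows of the three Hankel blocks of `u`; row `0` also sees the auxiliary entries. -/
def blockRow {N : ℕ} (u : ℕ → Fin 3 → ZMod 2) (i : ℕ) :
    KerSpace N →ₗ[ZMod 2] (Fin 3 → ZMod 2) where
  toFun v b := ∑ j : Fin N, u (i + j) b * v.1 j + if i = 0 then v.2 b else 0
  map_add' v w := by
    ext b
    by_cases hi : i = 0
    · simp [hi, mul_add, Finset.sum_add_distrib]
      ring
    · simp [hi, mul_add, Finset.sum_add_distrib]
  map_smul' c v := by
    ext b
    by_cases hi : i = 0 <;> simp [hi, Finset.mul_sum, mul_add, mul_left_comm]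

/-- The coefficient in position `m - d`. -/
def leadCoeff {N : ℕ} (m d : ℕ) : KerSpace N →ₗ[ZMod 2] ZMod 2 where
  toFun v := ∑ j : Fin N, if (j : ℕ) + d = m then v.1 j else 0
  map_add' v w := by
    rw [← Finset.sum_add_distrib]
    refine Finset.sum_congr rfl fun j _ => ?_
    split_ifs <;> simp
  map_smul' c v := by
    simp [Finset.mul_sum]

/-- Kernel vectors of the first `d` block rows supported in the first `m + 1 - d` columns, with
`ε` auxiliary columns. -/
def hankelKer (ε N : ℕ) (u : ℕ → Fin 3 → ZMod 2) (m d : ℕ) : Submodule (ZMod 2) (KerSpace N) where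
  carrier := {v | (∀ j : Fin N, m + 1 ≤ (j : ℕ) + d → v.1 j = 0) ∧
    (∀ b : Fin 3, ε ≤ (b : ℕ) → v.2 b = 0) ∧ ∀ i < d, blockRow u i v = 0}
  add_mem' := by
    rintro v w ⟨h1, h2, h3⟩ ⟨k1, k2, k3⟩
    refine ⟨fun j hj => ?_, fun b hb => ?_, fun i hi => ?_⟩
    · simp [h1 j hj, k1 j hj]
    · simp [h2 b hb, k2 b hb]
    · rw [map_add, h3 i hi, k3 i hi, add_zero]
  zero_mem' := by simp
  smul_mem' := by
    rintro c v ⟨h1, h2, h3⟩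
    refine ⟨fun j hj => ?_, fun b hb => ?_, fun i hi => ?_⟩
    · simp [h1 j hj]
    · simp [h2 b hb]
    · rw [map_smul, h3 i hi, smul_zero]

/-- The nullity of `hankelKer`. -/
noncomputable def nullityAt (ε N : ℕ) (u : ℕ → Fin 3 → ZMod 2) (m d : ℕ) : ℕ :=
  Module.finrank (ZMod 2) (hankelKer ε N u m d)

/-- Some kernel vector uses the last admissible column. -/
def LastUsed (ε N : ℕ) (u : ℕ → Fin 3 → ZMod 2) (m d : ℕ) : Prop :=
  ∃ v ∈ hankelKer ε N u m d, leadCoeff m d v = 1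

section

variable {ε N : ℕ} {u w : ℕ → Fin 3 → ZMod 2} {m d : ℕ}

theorem mem_hankelKer {v : KerSpace N} : v ∈ hankelKer ε N u m d ↔
    (∀ j : Fin N, m + 1 ≤ (j : ℕ) + d → v.1 j = 0) ∧
    (∀ b : Fin 3, ε ≤ (b : ℕ) → v.2 b = 0) ∧ ∀ i < d, blockRow u i v = 0 := Iff.rfl

/-- Row `i < d` meets only columns `j ≤ m - d`, so only the terms with index `i + j < m` matter. -/
theorem blockRow_congr (h : ∀ i < m, u i = w i) {v : KerSpace N}
    (hv : ∀ j : Fin N, m + 1 ≤ (j : ℕ) + d → v.1 j = 0) {i : ℕ} (hi : i < d) :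
    blockRow u i v = blockRow w i v := by
  ext b
  simp only [blockRow, LinearMap.coe_mk, AddHom.coe_mk]
  congr 1
  refine Finset.sum_congr rfl fun j _ => ?_
  by_cases hj : m + 1 ≤ (j : ℕ) + d
  · simp [hv j hj]
  · rw [h (i + j) (by omega)]

theorem hankelKer_congr (h : ∀ i < m, u i = w i) (d : ℕ) :
    hankelKer ε N u m d = hankelKer ε N w m d := by
  ext v
  simp only [mem_hankelKer]
  constructor
  · rintro ⟨h1, h2, h3⟩
    exact ⟨h1, h2, fun i hi => by rw [← blockRow_congr h h1 hi, h3 i hi]⟩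
  · rintro ⟨h1, h2, h3⟩
    exact ⟨h1, h2, fun i hi => by rw [blockRow_congr h h1 hi, h3 i hi]⟩

theorem nullityAt_congr (h : ∀ i < m, u i = w i) (d : ℕ) :
    nullityAt ε N u m d = nullityAt ε N w m d := by
  rw [nullityAt, nullityAt, hankelKer_congr h]

/-- Raising `m` and `d` together keeps the column bound `m + 1 - d` and only adds one block row. -/
theorem hankelKer_succ_succ :
    hankelKer ε N u (m + 1) (d + 1) = hankelKer ε N u m d ⊓ LinearMap.ker (blockRow u d) := by
  ext v
  simp only [mem_hankelKer, Submodule.mem_inf, LinearMap.mem_ker]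
  constructor
  · rintro ⟨h1, h2, h3⟩
    exact ⟨⟨fun j hj => h1 j (by omega), h2, fun i hi => h3 i (by omega)⟩, h3 d (by omega)⟩
  · rintro ⟨⟨h1, h2, h3⟩, h4⟩
    refine ⟨fun j hj => h1 j (by omega), h2, fun i hi => ?_⟩
    rcases Nat.lt_succ_iff_lt_or_eq.mp hi with h | rfl
    exacts [h3 i h, h4]

theorem leadCoeff_succ_succ : (leadCoeff (m + 1) (d + 1) : KerSpace N →ₗ[ZMod 2] ZMod 2) =
    leadCoeff m d := by
  ext v <;> simp [leadCoeff, ← add_assoc]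

theorem leadCoeff_eq_zero {v : KerSpace N} (h : ∀ j : Fin N, (j : ℕ) + d = m → v.1 j = 0) :
    leadCoeff m d v = 0 := by
  rw [leadCoeff, LinearMap.coe_mk, AddHom.coe_mk]
  refine Finset.sum_eq_zero fun j _ => ?_
  split_ifs with hj
  exacts [h j hj, rfl]

theorem leadCoeff_eq {v : KerSpace N} (j : Fin N) (hj : (j : ℕ) + d = m) :
    leadCoeff m d v = v.1 j := by
  rw [leadCoeff, LinearMap.coe_mk, AddHom.coe_mk, Finset.sum_eq_single j]
  · simp [hj]
  · intro b _ hb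
    rw [if_neg]
    exact fun h => hb (Fin.ext (by omega))
  · simp

theorem hankelKer_inf_leadCoeff :
    hankelKer ε N u (m + 1) d ⊓ LinearMap.ker (leadCoeff (m + 1) d) = hankelKer ε N u m d := by
  ext v
  simp only [mem_hankelKer, Submodule.mem_inf, LinearMap.mem_ker]
  constructor
  · rintro ⟨⟨h1, h2, h3⟩, h4⟩
    refine ⟨fun j hj => ?_, h2, h3⟩
    rcases Nat.eq_or_lt_of_le hj with h | h
    · rw [leadCoeff_eq j h.symm] at h4
      exact h4
    · exact h1 j h
  · rintro ⟨h1, h2, h3⟩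
    exact ⟨⟨fun j hj => h1 j (by omega), h2, h3⟩, leadCoeff_eq_zero fun j hj => h1 j (by omega)⟩

section finrank

variable {V W : Type*} [AddCommGroup V] [Module (ZMod 2) V]
  [AddCommGroup W] [Module (ZMod 2) W]

theorem finrank_map_add_finrank_inf_ker [FiniteDimensional (ZMod 2) V]
    (P : Submodule (ZMod 2) V) (f : V →ₗ[ZMod 2] W) :
    Module.finrank (ZMod 2) (P.map f) +
      Module.finrank (ZMod 2) (P ⊓ LinearMap.ker f : Submodule (ZMod 2) V) =
      Module.finrank (ZMod 2) P := by
  have h := LinearMap.finrank_range_add_finrank_ker (f.domRestrict P)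
  rw [LinearMap.range_domRestrict, LinearMap.ker_domRestrict] at h
  rw [← h, ← Submodule.finrank_map_subtype_eq P, Submodule.map_comap_subtype]

theorem finrank_eq_add_one_of_exists [FiniteDimensional (ZMod 2) V]
    (P : Submodule (ZMod 2) V) (f : V →ₗ[ZMod 2] ZMod 2)
    (h : ∃ v ∈ P, f v = 1) : Module.finrank (ZMod 2) P =
      Module.finrank (ZMod 2) (P ⊓ LinearMap.ker f : Submodule (ZMod 2) V) + 1 := by
  have hm : P.map f = ⊤ := by
    obtain ⟨v, hv, h1⟩ := h
    rw [eq_top_iff]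
    intro c _
    exact ⟨c • v, P.smul_mem c hv, by simp [h1]⟩
  have := finrank_map_add_finrank_inf_ker P f
  rw [hm, finrank_top, Module.finrank_self] at this
  omega

theorem inf_ker_eq_of_not_exists (P : Submodule (ZMod 2) V) (f : V →ₗ[ZMod 2] ZMod 2)
    (h : ¬∃ v ∈ P, f v = 1) : P ⊓ LinearMap.ker f = P := by
  refine inf_eq_left.mpr fun v hv => ?_
  by_contra h0
  refine h ⟨v, hv, ?_⟩
  rw [LinearMap.mem_ker] at h0
  revert h0
  generalize f v = c
  revert c
  decide

end finrank

theorem nullityAt_succ_of_lastUsed (h : LastUsed ε N u (m + 1) d) :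
    nullityAt ε N u (m + 1) d = nullityAt ε N u m d + 1 := by
  rw [nullityAt, nullityAt, finrank_eq_add_one_of_exists _ _ h, hankelKer_inf_leadCoeff]

theorem nullityAt_succ_of_not_lastUsed (h : ¬LastUsed ε N u (m + 1) d) :
    nullityAt ε N u (m + 1) d = nullityAt ε N u m d := by
  rw [nullityAt, nullityAt, ← inf_ker_eq_of_not_exists _ _ h, hankelKer_inf_leadCoeff]

theorem nullityAt_succ_le : nullityAt ε N u m (d + 1) ≤ nullityAt ε N u m d := by
  refine Submodule.finrank_mono fun v hv => ?_
  obtain ⟨h1, h2, h3⟩ := hv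
  exact ⟨fun j hj => h1 j (by omega), h2, fun i hi => h3 i (by omega)⟩

theorem hankelKer_succ_right : hankelKer ε N u m (d + 1) =
    hankelKer ε N u m d ⊓ LinearMap.ker (blockRow u d) ⊓ LinearMap.ker (leadCoeff m d) := by
  rw [← hankelKer_succ_succ, ← leadCoeff_succ_succ, hankelKer_inf_leadCoeff]

/-- Raising `d` by one imposes three new row equations and the vanishing of one coefficient. This is
why parts never exceed `4`. -/
theorem nullityAt_le_succ_add_four :
    nullityAt ε N u m d ≤ nullityAt ε N u m (d + 1) + 4 := by
  rw [nullityAt, nullityAt, hankelKer_succ_right,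
    ← finrank_map_add_finrank_inf_ker (hankelKer ε N u m d) (blockRow u d),
    ← finrank_map_add_finrank_inf_ker (_ ⊓ _) (leadCoeff m d)]
  have h1 := Submodule.finrank_le ((hankelKer ε N u m d).map (blockRow u d))
  have h2 := Submodule.finrank_le ((hankelKer ε N u m d ⊓ LinearMap.ker (blockRow u d)).map
    (leadCoeff m d))
  rw [Module.finrank_fin_fun] at h1
  rw [Module.finrank_self] at h2
  omega

/-- No column is left, and row `0`, present because `d > 0`, then reads off the auxiliary entries.
-/
theorem nullityAt_eq_zero (h : m < d) : nullityAt ε N u m d = 0 := by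
  rw [nullityAt, Submodule.finrank_eq_zero, eq_bot_iff]
  rintro ⟨p, c⟩ ⟨h1, h2, h3⟩
  have hp : p = 0 := funext fun j => h1 j (by omega)
  have h0 := h3 0 (by omega)
  have hc : c = 0 := by
    ext b
    simpa [blockRow, hp] using congrFun h0 b
  simp [hp, hc]

theorem not_lastUsed (h : m < d) : ¬LastUsed ε N u m d := by
  rintro ⟨v, _, hv⟩
  rw [leadCoeff_eq_zero fun j hj => by omega] at hv
  exact zero_ne_one hv

theorem lastUsed_zero (h : m < N) : LastUsed ε N u m 0 := by
  refine ⟨(Pi.single ⟨m, h⟩ 1, 0), ⟨fun j hj => ?_, by simp, by simp⟩, ?_⟩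
  · exact Pi.single_eq_of_ne (fun h => by simp [h] at hj) _
  · rw [leadCoeff_eq (m := m) (d := 0) ⟨m, h⟩ rfl]
    simp

/-- Multiplication by the variable: after shifting the coefficients up by one, row `i` becomes the
former row `i + 1`, which never sees the auxiliary entries. These can therefore be reset to zero. -/
theorem LastUsed.of_succ (hmN : m < N) (h : LastUsed ε N u m (d + 1)) :
    LastUsed ε N u m d := by
  obtain ⟨v, hv, hl⟩ := h
  rcases lt_or_ge m (d + 1) with hm | hm
  · exact absurd ⟨v, hv, hl⟩ (not_lastUsed hm)
  have hN : m - d < N := by omega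
  obtain ⟨h1, h2, h3⟩ := hv
  obtain ⟨n, rfl⟩ : ∃ n, N = n + 1 := ⟨N - 1, by omega⟩
  refine ⟨(fun j => Fin.cases 0 (fun k => v.1 k.castSucc) j, 0), ⟨?_, by simp, ?_⟩, ?_⟩
  · intro j
    refine Fin.cases (by simp) (fun k hk => ?_) j
    simp only [Fin.cases_succ]
    exact h1 _ (by simp at hk ⊢; omega)
  · intro i hi
    have h4 := h3 (i + 1) (by omega)
    ext b
    have h5 := congrFun h4 b
    simp only [blockRow, LinearMap.coe_mk, AddHom.coe_mk, Fin.sum_univ_castSucc, Fin.val_castSucc,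
      Fin.val_last] at h5
    have h6 : v.1 (Fin.last n) = 0 := h1 _ (by simp; omega)
    simp only [blockRow, LinearMap.coe_mk, AddHom.coe_mk, Fin.sum_univ_succ, Fin.cases_zero,
      Fin.cases_succ, Fin.val_succ]
    simpa [h6, add_assoc, add_comm 1] using h5
  · rw [← hl, leadCoeff_eq (d := d + 1) (⟨m - (d + 1), by omega⟩ : Fin (n + 1)) (by simp; omega),
      leadCoeff_eq (⟨m - d, hN⟩ : Fin (n + 1)) (by simp; omega)]
    have : (⟨m - d, hN⟩ : Fin (n + 1)) = Fin.succ ⟨m - (d + 1), by omega⟩ := by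
      ext
      simp
      omega
    rw [this]
    rfl

theorem nullityAt_zero_zero (hε : ε ≤ 1) (hN : 0 < N) : nullityAt ε N u 0 0 = 1 + ε := by
  rw [nullityAt, finrank_eq_add_one_of_exists _ _ (lastUsed_zero hN), add_comm]
  congr 1
  interval_cases ε
  · rw [Submodule.finrank_eq_zero, eq_bot_iff]
    rintro ⟨p, c⟩ ⟨⟨h1, h2, -⟩, h3⟩
    have h0 := (leadCoeff_eq (d := 0) (⟨0, hN⟩ : Fin N) rfl).symm.trans h3
    have hp : p = 0 := by
      ext j
      rcases Nat.eq_zero_or_pos (j : ℕ) with h | h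
      · rw [show j = ⟨0, hN⟩ from Fin.ext h]
        exact h0
      · exact h1 j (by omega)
    have hc : c = 0 := funext fun b => h2 b (Nat.zero_le _)
    simp [hp, hc]
  · let f : KerSpace N →ₗ[ZMod 2] ZMod 2 := LinearMap.proj 0 ∘ₗ LinearMap.snd _ _ _
    rw [finrank_eq_add_one_of_exists _ f]
    · rw [Nat.add_eq_right, Submodule.finrank_eq_zero, eq_bot_iff]
      rintro ⟨p, c⟩ ⟨⟨⟨h1, h2, -⟩, h3⟩, h4⟩
      have h0 := (leadCoeff_eq (d := 0) (⟨0, hN⟩ : Fin N) rfl).symm.trans h3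
      have hp : p = 0 := by
        ext j
        rcases Nat.eq_zero_or_pos (j : ℕ) with h | h
        · rw [show j = ⟨0, hN⟩ from Fin.ext h]
          exact h0
        · exact h1 j (by omega)
      have hc : c = 0 := by
        ext b
        rcases Nat.eq_zero_or_pos (b : ℕ) with h | h
        · rw [show b = 0 from Fin.ext h]
          exact h4
        · exact h2 b h
      simp [hp, hc]
    · refine ⟨(0, Pi.single 0 1), ⟨⟨by simp, fun b hb => ?_, by simp⟩, ?_⟩, by simp [f]⟩
      · exact Pi.single_eq_of_ne (fun h => by simp [h] at hb) _
      · exact leadCoeff_eq_zero (by simp)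

theorem nullityAt_zero (hε : ε ≤ 1) (hm : m < N) : nullityAt ε N u m 0 = m + 1 + ε := by
  induction m with
  | zero => rw [nullityAt_zero_zero hε hm, zero_add]
  | succ m ih =>
    rw [nullityAt_succ_of_lastUsed (lastUsed_zero hm), ih (by omega)]
    omega

theorem blockRow_update {v : KerSpace N} (hu : u m = 0)
    (ξ : Fin 3 → ZMod 2) :
    blockRow (Function.update u m ξ) d v = blockRow u d v + leadCoeff m d v • ξ := by
  ext b
  simp only [blockRow, leadCoeff, LinearMap.coe_mk, AddHom.coe_mk, Pi.add_apply, Pi.smul_apply,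
    smul_eq_mul, Finset.sum_mul]
  rw [add_right_comm, ← Finset.sum_add_distrib]
  congr 1
  refine Finset.sum_congr rfl fun j _ => ?_
  by_cases hj : (j : ℕ) + d = m
  · rw [add_comm d, hj, if_pos rfl, hu]
    simp [mul_comm]
  · rw [if_neg hj, Function.update_of_ne (by omega)]
    simp

/-- In row `d` the new term `ξ` multiplies only the last coefficient. If that is `1`, the row
equation says that `ξ` equals the value of the row without it. -/
theorem lastUsed_succ_iff (hu : u m = 0) (ξ : Fin 3 → ZMod 2) :
    LastUsed ε N (Function.update u m ξ) (m + 1) (d + 1) ↔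
      ∃ v ∈ hankelKer ε N u m d, leadCoeff m d v = 1 ∧ blockRow u d v = ξ := by
  rw [LastUsed, hankelKer_succ_succ, leadCoeff_succ_succ,
    hankelKer_congr (w := u) fun i hi => Function.update_of_ne hi.ne _ _]
  simp only [Submodule.mem_inf, LinearMap.mem_ker, and_assoc]
  refine exists_congr fun v => and_congr_right fun hv => ?_
  rw [blockRow_update hu]
  constructor
  · rintro ⟨h1, h2⟩
    rw [h2, one_smul] at h1
    exact ⟨h2, (CharTwo.add_eq_zero).mp h1⟩
  · rintro ⟨h1, h2⟩
    rw [h1, h2, one_smul]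
    exact ⟨CharTwo.add_self_eq_zero _, rfl⟩

/-- The admissible `ξ` form a coset of the image under row `d` of the solutions with last
coefficient `0`. These have dimension one less than the nullity at `d`, and the kernel of row `d` on
them is the solution space at `d + 1`. -/
theorem ncard_lastUsed_succ (hu : u m = 0) (h : LastUsed ε N u m d) :
    {ξ | LastUsed ε N (Function.update u m ξ) (m + 1) (d + 1)}.ncard * 2 =
      2 ^ (nullityAt ε N u m d - nullityAt ε N u m (d + 1)) := by
  have hfin := finrank_eq_add_one_of_exists _ _ h
  obtain ⟨v₀, hv₀, hl₀⟩ := h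
  set Q := hankelKer ε N u m d ⊓ LinearMap.ker (leadCoeff m d) with hQ
  have hset : {ξ | LastUsed ε N (Function.update u m ξ) (m + 1) (d + 1)} =
      (fun x => x + blockRow u d v₀) '' (Q.map (blockRow u d) : Set (Fin 3 → ZMod 2)) := by
    ext ξ
    simp only [Set.mem_ofPred_eq, lastUsed_succ_iff hu, Set.mem_image, SetLike.mem_coe,
      Submodule.mem_map]
    constructor
    · rintro ⟨v, hv, h1, h2⟩
      refine ⟨_, ⟨v - v₀, ⟨Submodule.sub_mem _ hv hv₀, ?_⟩, rfl⟩, ?_⟩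
      · simp [h1, hl₀]
      · rw [map_sub, sub_add_cancel, h2]
    · rintro ⟨_, ⟨v, ⟨hv, hv'⟩, rfl⟩, rfl⟩
      refine ⟨v + v₀, Submodule.add_mem _ hv hv₀, ?_, map_add _ _ _⟩
      rw [map_add, hl₀, LinearMap.mem_ker.mp hv', zero_add]
  have hcard : Nat.card (Q.map (blockRow u d)) =
      2 ^ Module.finrank (ZMod 2) (Q.map (blockRow u d)) := by
    rw [Module.natCard_eq_pow_finrank (K := ZMod 2), Nat.card_zmod]
  rw [hset, Set.ncard_image_of_injective _ (add_left_injective _), ← Nat.card_coe_set_eq,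
    SetLike.coe_sort_coe, hcard, ← pow_succ]
  congr 1
  have h1 := finrank_map_add_finrank_inf_ker Q (blockRow u d)
  have h2 : Q ⊓ LinearMap.ker (blockRow u d) = hankelKer ε N u m (d + 1) := by
    rw [hankelKer_succ_right, hQ, inf_right_comm]
  rw [h2] at h1
  rw [nullityAt, nullityAt, hfin]
  omega

theorem ncard_lastUsed_succ_of_not (hu : u m = 0) (h : ¬LastUsed ε N u m d) :
    {ξ | LastUsed ε N (Function.update u m ξ) (m + 1) (d + 1)}.ncard = 0 := by
  rw [Set.ncard_eq_zero, Set.eq_empty_iff_forall_notMem]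
  rintro ξ hξ
  obtain ⟨v, hv, h1, -⟩ := (lastUsed_succ_iff hu ξ).mp hξ
  exact h ⟨v, hv, h1⟩

end

/-! ### Splitting types and the recursion for their counts. -/

section

variable {ε N m : ℕ}

/-- Extension of a finite sequence by zero. -/
def seqOf (u : Fin m → Fin 3 → ZMod 2) : ℕ → Fin 3 → ZMod 2 :=
  fun i => if h : i < m then u ⟨i, h⟩ else 0

/-- The conjugate partition of the splitting type attached to a sequence of length `m`. -/
noncomputable def splitType (ε N : ℕ) (u : ℕ → Fin 3 → ZMod 2) (m : ℕ) : ℕ → ℕ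
  | 0 => 4
  | d + 1 => nullityAt ε N u m d - nullityAt ε N u m (d + 1)

open Classical in
/-- The number of sequences of length `m` of splitting type `r` that satisfy `LastUsed` at `d`. -/
noncomputable def typeCount (ε N m : ℕ) (r : ℕ → ℕ) (d : ℕ) : ℚ :=
  ∑ u : Fin m → Fin 3 → ZMod 2,
    if splitType ε N (seqOf u) m = r then if LastUsed ε N (seqOf u) m d then 1 else 0 else 0

theorem seqOf_apply_self (u : Fin m → Fin 3 → ZMod 2) : seqOf u m = 0 := by
  simp [seqOf]

theorem seqOf_snoc (u : Fin m → Fin 3 → ZMod 2) (ξ : Fin 3 → ZMod 2) :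
    seqOf (Fin.snoc (α := fun _ => Fin 3 → ZMod 2) u ξ) = Function.update (seqOf u) m ξ := by
  funext i
  rcases lt_trichotomy i m with h | rfl | h
  · rw [Function.update_of_ne h.ne]
    simp [seqOf, Fin.snoc, h, Nat.lt_succ_of_lt h]
  · rw [Function.update_self]
    simp [seqOf, Fin.snoc]
  · rw [Function.update_of_ne h.ne']
    simp [seqOf, h.le.not_gt, show ¬i < m + 1 by omega]

theorem splitType_congr {u w : ℕ → Fin 3 → ZMod 2} (h : ∀ i < m, u i = w i) :
    splitType ε N u m = splitType ε N w m := by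
  funext d
  cases d with
  | zero => rfl
  | succ d => rw [splitType, splitType, nullityAt_congr h, nullityAt_congr h]

theorem splitType_le_four {u : ℕ → Fin 3 → ZMod 2} (d : ℕ) : splitType ε N u m d ≤ 4 := by
  cases d with
  | zero => exact le_rfl
  | succ d =>
    have := nullityAt_le_succ_add_four (ε := ε) (N := N) (u := u) (m := m) (d := d)
    rw [splitType]
    omega

theorem LastUsed.of_le {u : ℕ → Fin 3 → ZMod 2} (hm : m < N) {d e : ℕ} (hde : e ≤ d)
    (h : LastUsed ε N u m d) : LastUsed ε N u m e := by
  induction hde with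
  | refl => exact h
  | step _ ih => exact ih (h.of_succ hm)

/-- `LastUsed` is downward closed in `d`, so it switches off once. Nullities before the switch grow
by one and later ones stay, hence only the difference across the switch changes. -/
theorem splitType_succ {u : ℕ → Fin 3 → ZMod 2} (hm : m + 1 < N) {d : ℕ}
    (h1 : LastUsed ε N u (m + 1) d) (h2 : ¬LastUsed ε N u (m + 1) (d + 1)) :
    splitType ε N u (m + 1) =
      Function.update (splitType ε N u m) (d + 1) (splitType ε N u m (d + 1) + 1) := by
  have hle : ∀ e ≤ d, nullityAt ε N u (m + 1) e = nullityAt ε N u m e + 1 := fun e he =>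
    nullityAt_succ_of_lastUsed (h1.of_le hm he)
  have hgt : ∀ e, d < e → nullityAt ε N u (m + 1) e = nullityAt ε N u m e := fun e he =>
    nullityAt_succ_of_not_lastUsed fun h => h2 (h.of_le hm he)
  have hmono := fun e => nullityAt_succ_le (ε := ε) (N := N) (u := u) (m := m) (d := e)
  funext e
  cases e with
  | zero => rw [Function.update_of_ne (by omega)]; rfl
  | succ e =>
    rcases lt_trichotomy e d with h | rfl | h
    · rw [Function.update_of_ne (by omega), splitType, splitType, hle e h.le, hle (e + 1) h]
      omega
    · rw [Function.update_self, splitType, splitType, hle e le_rfl, hgt (e + 1) (by omega)]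
      have := hmono e
      omega
    · rw [Function.update_of_ne (by omega), splitType, splitType, hgt e h,
        hgt (e + 1) (by omega)]

open Classical in
theorem sum_lastUsed_zero (hm : m + 1 < N) (u : ℕ → Fin 3 → ZMod 2) :
    ∑ ξ : Fin 3 → ZMod 2,
      (if LastUsed ε N (Function.update u m ξ) (m + 1) 0 then (1 : ℚ) else 0) = 8 := by
  simp only [lastUsed_zero hm, if_true]
  simp [ZMod.card]

open Classical in
theorem sum_lastUsed_succ {u : ℕ → Fin 3 → ZMod 2} (hu : u m = 0) (d : ℕ) :
    ∑ ξ : Fin 3 → ZMod 2,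
      (if LastUsed ε N (Function.update u m ξ) (m + 1) (d + 1) then (1 : ℚ) else 0) =
      if LastUsed ε N u m d then 2 ^ splitType ε N u m (d + 1) / 2 else 0 := by
  rw [Finset.sum_boole]
  have hc : ((Finset.univ.filter fun ξ : Fin 3 → ZMod 2 =>
      LastUsed ε N (Function.update u m ξ) (m + 1) (d + 1)).card : ℚ) =
      ({ξ | LastUsed ε N (Function.update u m ξ) (m + 1) (d + 1)}.ncard : ℚ) := by
    rw [Set.ncard_eq_toFinset_card']
    congr 2
    ext
    simp
  rw [hc]
  split_ifs with h
  · rw [splitType, eq_div_iff two_ne_zero]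
    exact_mod_cast ncard_lastUsed_succ hu h
  · exact_mod_cast ncard_lastUsed_succ_of_not hu h

theorem sum_snoc (f : (Fin (m + 1) → Fin 3 → ZMod 2) → ℚ) :
    ∑ u, f u = ∑ u : Fin m → Fin 3 → ZMod 2, ∑ ξ : Fin 3 → ZMod 2,
      f (Fin.snoc (α := fun _ => Fin 3 → ZMod 2) u ξ) := by
  rw [← (Fin.snocEquiv fun _ : Fin (m + 1) => (Fin 3 → ZMod 2)).sum_comp, Fintype.sum_prod_type,
    Finset.sum_comm]
  rfl

theorem typeCount_sub_of_eq_zero (hm : m + 1 < N) {r : ℕ → ℕ} {d : ℕ} (h0 : r (d + 1) = 0) :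
    typeCount ε N (m + 1) r d - typeCount ε N (m + 1) r (d + 1) = 0 := by
  rw [typeCount, typeCount, ← Finset.sum_sub_distrib]
  refine Finset.sum_eq_zero fun u _ => ?_
  by_cases hr : splitType ε N (seqOf u) (m + 1) = r
  · by_cases h1 : LastUsed ε N (seqOf u) (m + 1) d
    · by_cases h2 : LastUsed ε N (seqOf u) (m + 1) (d + 1)
      · simp [h1, h2]
      · have := congrFun (splitType_succ hm h1 h2) (d + 1)
        rw [Function.update_self, hr, h0] at this
        omega
    · have h2 : ¬LastUsed ε N (seqOf u) (m + 1) (d + 1) := fun h => h1 (h.of_succ hm)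
      simp [h1, h2]
  · rw [if_neg hr, if_neg hr, sub_zero]

-- The left side counts the sequences whose switch lies exactly at `d`. Removing their last term
-- lowers part `d + 1` by one, which fixes the type of the truncated sequence.
open Classical in
theorem typeCount_sub (hm : m + 1 < N) {r : ℕ → ℕ} {d b : ℕ} (hb : r (d + 1) = b + 1) :
    typeCount ε N (m + 1) r d - typeCount ε N (m + 1) r (d + 1) =
      ∑ u : Fin m → Fin 3 → ZMod 2,
        if splitType ε N (seqOf u) m = Function.update r (d + 1) b then
          (∑ ξ : Fin 3 → ZMod 2,
            if LastUsed ε N (Function.update (seqOf u) m ξ) (m + 1) d then (1 : ℚ) else 0) -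
          ∑ ξ : Fin 3 → ZMod 2,
            if LastUsed ε N (Function.update (seqOf u) m ξ) (m + 1) (d + 1) then (1 : ℚ) else 0
        else 0 := by
  rw [typeCount, typeCount, sum_snoc, sum_snoc, ← Finset.sum_sub_distrib]
  refine Finset.sum_congr rfl fun u _ => ?_
  rw [← Finset.sum_sub_distrib, ← Finset.sum_sub_distrib,
    show ∀ (p : Prop) [Decidable p] (f : (Fin 3 → ZMod 2) → ℚ),
      (if p then ∑ x, f x else 0) = ∑ x, if p then f x else 0 from
      fun p _ f => by split_ifs <;> simp]
  refine Finset.sum_congr rfl fun ξ _ => ?_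
  rw [seqOf_snoc, ← splitType_congr (u := Function.update (seqOf u) m ξ) (w := seqOf u)
    fun i hi => Function.update_of_ne hi.ne _ _]
  set w := Function.update (seqOf u) m ξ
  by_cases h1 : LastUsed ε N w (m + 1) d
  · by_cases h2 : LastUsed ε N w (m + 1) (d + 1)
    · simp [h1, h2]
    · have hs := splitType_succ hm h1 h2
      have hiff : splitType ε N w (m + 1) = r ↔
          splitType ε N w m = Function.update r (d + 1) b := by
        rw [hs]
        constructor
        · intro h
          have h' := congrFun h (d + 1)
          rw [Function.update_self, hb] at h'
          rw [← h, Function.update_idem, show b = splitType ε N w m (d + 1) by omega,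
            Function.update_eq_self]
        · intro h
          rw [h, Function.update_self, Function.update_idem, ← hb, Function.update_eq_self]
      simp [h1, h2, hiff]
  · have h2 : ¬LastUsed ε N w (m + 1) (d + 1) := fun h => h1 (h.of_succ hm)
    simp [h1, h2]

theorem typeCount_sub_zero (hm : m + 1 < N) {r : ℕ → ℕ} {b : ℕ} (hb : r 1 = b + 1) :
    typeCount ε N (m + 1) r 0 - typeCount ε N (m + 1) r 1 =
      typeCount ε N m (Function.update r 1 b) 0 * (8 - 2 ^ b / 2) := by
  rw [typeCount_sub hm (by simpa using hb), typeCount, Finset.sum_mul]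
  refine Finset.sum_congr rfl fun u _ => ?_
  rw [sum_lastUsed_zero hm, sum_lastUsed_succ (seqOf_apply_self u)]
  have h0 : LastUsed ε N (seqOf u) m 0 := lastUsed_zero (by omega)
  by_cases h : splitType ε N (seqOf u) m = Function.update r 1 b
  · simp [h, h0]
  · simp [h]

theorem typeCount_sub_succ (hm : m + 1 < N) {r : ℕ → ℕ} {d b : ℕ} (hb : r (d + 2) = b + 1) :
    typeCount ε N (m + 1) r (d + 1) - typeCount ε N (m + 1) r (d + 2) =
      typeCount ε N m (Function.update r (d + 2) b) d * (2 ^ r (d + 1) / 2) -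
      typeCount ε N m (Function.update r (d + 2) b) (d + 1) * (2 ^ b / 2) := by
  rw [typeCount_sub hm hb, typeCount, typeCount, Finset.sum_mul, Finset.sum_mul,
    ← Finset.sum_sub_distrib]
  refine Finset.sum_congr rfl fun u _ => ?_
  rw [sum_lastUsed_succ (seqOf_apply_self u), sum_lastUsed_succ (seqOf_apply_self u)]
  by_cases h : splitType ε N (seqOf u) m = Function.update r (d + 2) b
  · rw [if_pos h, h, Function.update_of_ne (by omega), Function.update_self]
    simp
  · rw [if_neg h, if_neg h, if_neg h]
    simp

theorem typeCount_eq_zero {r : ℕ → ℕ} {d : ℕ} (h : m < d) : typeCount ε N m r d = 0 := by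
  simp [typeCount, not_lastUsed h]

end

/-! ### The product formula for the number of sequences of a given type. -/

/-- The `2`-analogue of the factorial. -/
def qFact (n : ℕ) : ℚ := ∏ i ∈ Finset.range n, (2 ^ (i + 1) - 1)

/-- The contribution of consecutive parts `x`, `y` of a conjugate partition. -/
def stepWeight (x y : ℕ) : ℚ := if y ≤ x then 2 ^ (x * (x - 1)) / qFact (x - y) else 0

/-- The contribution of all parts of a conjugate partition. -/
def pathWeight (N : ℕ) (r : ℕ → ℕ) : ℚ :=
  ∏ d ∈ Finset.range N, stepWeight (r (d + 1)) (r (d + 2))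

/-- The conditions on the two leading parts under which weights count splitting types. -/
structure IsStartWeight (ε : ℕ) (K L : ℕ → ℕ → ℚ) : Prop where
  zero : ∀ b ≤ ε, ∀ a, K b a = 0 ∧ L b a = 0
  one : K (1 + ε) 0 * stepWeight (1 + ε) 0 = 1
  first : ∀ b ≤ 3, ∀ a ≤ 4, (b = ε → a ≠ 0) →
    (K (b + 1) a - L (b + 1) a * (1 - 1 / 2 ^ a)) * stepWeight (b + 1) a =
      K b a * stepWeight b a * (8 - 2 ^ b / 2)
  second : ∀ c ≤ 4, ∀ b ≤ 3, ∀ a ≤ 4,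
    L c (b + 1) * (stepWeight c (b + 1) * stepWeight (b + 1) a) * (1 / 2 ^ a - 1 / 2 ^ (b + 1)) =
      stepWeight c b * stepWeight b a *
        (K c b * (2 ^ c / 2) - L c b * (1 - 1 / 2 ^ b) * (2 ^ b / 2))

theorem stepWeight_of_lt {x y : ℕ} (h : x < y) : stepWeight x y = 0 := if_neg h.not_ge

/-- The local identity behind the recursion away from the first two parts: raising the middle one of
three neighbouring parts affects only two factors. All parts are at most `4`, so it is a finite
check. -/
theorem stepWeight_exchange {a b c : ℕ} (hc : c ≤ 4) (hb : b ≤ 3) (ha : a ≤ 4) :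
    stepWeight c (b + 1) * stepWeight (b + 1) a * (1 / 2 ^ a - 1 / 2 ^ (b + 1)) =
      stepWeight c b * stepWeight b a *
        ((1 - 1 / 2 ^ c) * (2 ^ c / 2) - (1 - 1 / 2 ^ b) * (2 ^ b / 2)) := by
  interval_cases b <;> interval_cases c <;> interval_cases a <;>
    norm_num [stepWeight, qFact, Finset.prod_range_succ]

section

variable {ε N m : ℕ} {K L : ℕ → ℕ → ℚ}

theorem pathWeight_eq_zero {r : ℕ → ℕ} {d : ℕ} (hd : d < N) (h : r (d + 1) < r (d + 2)) :
    pathWeight N r = 0 :=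
  Finset.prod_eq_zero (Finset.mem_range.mpr hd) (stepWeight_of_lt h)

theorem exists_pathWeight_update {d : ℕ} (hd : d + 1 < N) (r : ℕ → ℕ) : ∃ R : ℚ, ∀ x,
    pathWeight N (Function.update r (d + 2) x) =
      stepWeight (r (d + 1)) x * stepWeight x (r (d + 3)) * R := by
  refine ⟨∏ e ∈ ((Finset.range N).erase d).erase (d + 1), stepWeight (r (e + 1)) (r (e + 2)),
    fun x => ?_⟩
  rw [pathWeight, ← Finset.mul_prod_erase _ _ (Finset.mem_range.mpr (by omega : d < N)),
    ← Finset.mul_prod_erase _ _ (Finset.mem_erase.mpr ⟨by omega, Finset.mem_range.mpr hd⟩),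
    ← mul_assoc]
  congr 1
  · rw [show d + 1 + 1 = d + 2 from rfl, Function.update_self, Function.update_of_ne (by omega),
      Function.update_of_ne (by omega)]
  · refine Finset.prod_congr rfl fun e he => ?_
    simp only [Finset.mem_erase] at he
    rw [Function.update_of_ne (by omega), Function.update_of_ne (by omega)]

theorem exists_pathWeight_update_one (hN : 0 < N) (r : ℕ → ℕ) : ∃ R : ℚ, ∀ x,
    pathWeight N (Function.update r 1 x) = stepWeight x (r 2) * R := by
  obtain ⟨n, rfl⟩ : ∃ n, N = n + 1 := ⟨N - 1, by omega⟩
  refine ⟨∏ e ∈ Finset.range n, stepWeight (r (e + 2)) (r (e + 3)), fun x => ?_⟩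
  rw [pathWeight, Finset.prod_range_succ', mul_comm]
  congr 1

theorem sum_update_pred {r : ℕ → ℕ} {d b : ℕ} (hd : d < N) (hb : r (d + 1) = b + 1) :
    ∑ e ∈ Finset.range N, Function.update r (d + 1) b (e + 1) + 1 =
      ∑ e ∈ Finset.range N, r (e + 1) := by
  rw [← Finset.add_sum_erase _ _ (Finset.mem_range.mpr hd),
    ← Finset.add_sum_erase _ (fun e => r (e + 1)) (Finset.mem_range.mpr hd),
    Function.update_self, hb, add_right_comm]
  congr 1
  refine Finset.sum_congr rfl fun e he => Function.update_of_ne ?_ _ _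
  have := Finset.ne_of_mem_erase he
  omega

theorem splitType_zero (hε : ε ≤ 1) (hN : 0 < N) (u : ℕ → Fin 3 → ZMod 2) (d : ℕ) :
    splitType ε N u 0 (d + 1) = if d = 0 then 1 + ε else 0 := by
  rw [splitType, nullityAt_eq_zero (d := d + 1) (by omega)]
  split_ifs with h
  · rw [h, nullityAt_zero_zero hε hN]; rfl
  · rw [nullityAt_eq_zero (by omega)]

theorem eq_of_sum_le {r : ℕ → ℕ} {s : ℕ} (hsupp : ∀ d, N < d → r d = 0)
    (hsum : ∑ d ∈ Finset.range N, r (d + 1) = s) (h1 : r 1 = s) (d : ℕ) : r (d + 2) = 0 := by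
  rcases Nat.lt_or_ge (d + 1) N with h | h
  · rw [← Finset.add_sum_erase _ _ (Finset.mem_range.mpr (by omega : 0 < N)), zero_add,
      h1] at hsum
    have := Finset.sum_eq_zero_iff.mp (Nat.add_eq_left.mp hsum) (d + 1)
      (Finset.mem_erase.mpr ⟨by omega, Finset.mem_range.mpr h⟩)
    exact this
  · exact hsupp _ (by omega)

theorem typeCount_zero_eq (hK : IsStartWeight ε K L) (hε : ε ≤ 1) (hN : 0 < N) {r : ℕ → ℕ}
    (h0 : r 0 = 4) (hsupp : ∀ d, N < d → r d = 0)
    (hsum : ∑ d ∈ Finset.range N, r (d + 1) = 1 + ε) :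
    typeCount ε N 0 r 0 = K (r 1) (r 2) * pathWeight N r ∧ ∀ d, typeCount ε N 0 r (d + 1) =
      L (r 1) (r 2) * pathWeight N r * (1 - 1 / 2 ^ r (d + 2)) := by
  have hr1 : r 1 ≤ 1 + ε := by
    rw [← hsum]
    exact Finset.single_le_sum (f := fun d => r (d + 1)) (fun _ _ => Nat.zero_le _)
      (Finset.mem_range.mpr hN)
  rcases Nat.lt_or_ge (r 1) (1 + ε) with h | h
  · obtain ⟨hk, hl⟩ := hK.zero (r 1) (by omega) (r 2)
    refine ⟨?_, fun d => ?_⟩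
    · rw [hk, zero_mul]
      refine Finset.sum_eq_zero fun u _ => if_neg fun hu => ?_
      have := splitType_zero hε hN (seqOf u) 0
      rw [hu, if_pos rfl, zero_add] at this
      omega
    · rw [hl, typeCount_eq_zero (by omega)]
      ring
  · have h1 : r 1 = 1 + ε := by omega
    have h2 := eq_of_sum_le hsupp hsum h1
    refine ⟨?_, fun d => ?_⟩
    · have hp : pathWeight N r = stepWeight (1 + ε) 0 := by
        obtain ⟨n, rfl⟩ : ∃ n, N = n + 1 := ⟨N - 1, by omega⟩
        rw [pathWeight, Finset.prod_range_succ', h1, h2, Finset.prod_eq_one, one_mul]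
        intro e _
        rw [h2, h2]
        norm_num [stepWeight, qFact]
      rw [hp, h1, h2, hK.one, typeCount, Fintype.sum_unique, if_pos, if_pos (lastUsed_zero hN)]
      funext d
      rcases d with - | - | d
      · exact h0.symm
      · rw [splitType_zero hε hN, if_pos rfl, h1]
      · rw [splitType_zero hε hN, if_neg (by omega), h2]
    · rw [typeCount_eq_zero (by omega), h2 d]
      simp

theorem le_of_pathWeight_ne_zero {r : ℕ → ℕ} (h : pathWeight N r ≠ 0) {d : ℕ} (hd : d < N) :
    r (d + 2) ≤ r (d + 1) := by
  by_contra hlt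
  exact h (pathWeight_eq_zero hd (not_le.mp hlt))

/-- Nonzero weight forces decreasing parts, so nothing can follow a vanishing second part. -/
theorem pathWeight_eq_zero_of_sum {r : ℕ → ℕ} (h2 : r 2 = 0)
    (hsum : r 1 < ∑ d ∈ Finset.range N, r (d + 1)) : pathWeight N r = 0 := by
  by_contra hne
  have hz : ∀ d, d < N → d ≠ 0 → r (d + 1) = 0 := by
    intro d
    induction d with
    | zero => exact fun _ h => absurd rfl h
    | succ d ih =>
      intro hd _
      rcases Nat.eq_zero_or_pos d with rfl | hpos
      · exact h2
      · have h1 := le_of_pathWeight_ne_zero hne (d := d) (by omega)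
        rw [ih (by omega) (by omega)] at h1
        exact Nat.le_zero.mp h1
  rcases Nat.eq_zero_or_pos N with rfl | hN
  · simp at hsum
  · rw [Finset.sum_eq_single_of_mem 0 (Finset.mem_range.mpr hN)
      fun d hd h => hz d (Finset.mem_range.mp hd) h, zero_add] at hsum
    exact lt_irrefl _ hsum

/-- Induction on the length: the recursion gives the differences in `d`, and these telescope because
`1 - 1 / 2 ^ r (d + 2)` is the part of the formula that depends on `d`. The count at `d = 0` comes
last and uses `IsStartWeight.first`. -/
theorem typeCount_eq (hK : IsStartWeight ε K L) (hε : ε ≤ 1) (hm : m < N) {r : ℕ → ℕ}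
    (h0 : r 0 = 4) (h4 : ∀ d, r d ≤ 4) (hsupp : ∀ d, N < d → r d = 0)
    (hsum : ∑ d ∈ Finset.range N, r (d + 1) = m + 1 + ε) :
    typeCount ε N m r 0 = K (r 1) (r 2) * pathWeight N r ∧ ∀ d, typeCount ε N m r (d + 1) =
      L (r 1) (r 2) * pathWeight N r * (1 - 1 / 2 ^ r (d + 2)) := by
  induction m generalizing r with
  | zero => exact typeCount_zero_eq hK hε hm h0 hsupp (by omega)
  | succ m ih =>
    have hpred : ∀ d b, d < N → r (d + 1) = b + 1 →
        typeCount ε N m (Function.update r (d + 1) b) 0 =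
          K (Function.update r (d + 1) b 1) (Function.update r (d + 1) b 2) *
            pathWeight N (Function.update r (d + 1) b) ∧
        ∀ e, typeCount ε N m (Function.update r (d + 1) b) (e + 1) =
          L (Function.update r (d + 1) b 1) (Function.update r (d + 1) b 2) *
            pathWeight N (Function.update r (d + 1) b) *
            (1 - 1 / 2 ^ Function.update r (d + 1) b (e + 2)) := by
      intro d b hd hb
      refine ih (by omega) ?_ (fun e => ?_) (fun e he => ?_) ?_
      · rw [Function.update_of_ne (by omega), h0]
      · rw [Function.update_apply]
        split_ifs
        · have := h4 (d + 1)
          omega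
        · exact h4 e
      · rw [Function.update_of_ne (by omega), hsupp e he]
      · have := sum_update_pred hd hb
        omega
    have hstep : ∀ d, d + 1 < N → typeCount ε N (m + 1) r (d + 1) -
        typeCount ε N (m + 1) r (d + 2) =
        L (r 1) (r 2) * pathWeight N r * (1 / 2 ^ r (d + 3) - 1 / 2 ^ r (d + 2)) := by
      intro d hd
      obtain ⟨R, hR⟩ := exists_pathWeight_update hd r
      have hRr := hR (r (d + 2))
      rw [Function.update_eq_self] at hRr
      rcases hb : r (d + 2) with - | b
      · rw [typeCount_sub_of_eq_zero hm hb]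
        rcases Nat.eq_zero_or_pos (r (d + 3)) with h3 | h3
        · simp [h3]
        · rw [pathWeight_eq_zero hd (show r (d + 2) < r (d + 3) by omega)]
          ring
      · have hb3 : b ≤ 3 := by
          have := h4 (d + 2)
          omega
        rw [typeCount_sub_succ hm hb]
        obtain ⟨hp0, hp1⟩ := hpred (d + 1) b hd hb
        rw [hb] at hRr
        rcases d with - | d
        · rw [hp0, hp1, hR, hRr]
          simp only [Nat.reduceAdd, zero_add, Function.update_self, ne_eq, OfNat.one_ne_ofNat,
            not_false_eq_true, Function.update_of_ne, hb] at *
          linear_combination -R * hK.second (r 1) (h4 1) b hb3 (r 3) (h4 3)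
        · rw [hp1, hp1, hR, hRr, Function.update_of_ne (by omega : (1 : ℕ) ≠ d + 1 + 1 + 1),
            Function.update_of_ne (by omega : (2 : ℕ) ≠ d + 1 + 1 + 1),
            Function.update_of_ne (by omega : d + 2 ≠ d + 1 + 1 + 1), Function.update_self,
            show d + 1 + 1 = d + 2 from rfl]
          linear_combination -L (r 1) (r 2) * R *
            stepWeight_exchange (h4 (d + 2)) hb3 (h4 (d + 4))
    -- Telescoping runs downwards from `d + 1 = N`, where `LastUsed` is impossible and part `d + 2`
    -- vanishes.
    have hlast : ∀ k d, d + k + 1 = N → typeCount ε N (m + 1) r (d + 1) =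
        L (r 1) (r 2) * pathWeight N r * (1 - 1 / 2 ^ r (d + 2)) := by
      intro k
      induction k with
      | zero =>
        intro d hd
        rw [typeCount_eq_zero (by omega), hsupp (d + 2) (by omega)]
        simp
      | succ k ihk =>
        intro d hd
        have h1 := ihk (d + 1) (by omega)
        have h2 := hstep d (by omega)
        linear_combination h1 + h2
    have hall : ∀ d, typeCount ε N (m + 1) r (d + 1) =
        L (r 1) (r 2) * pathWeight N r * (1 - 1 / 2 ^ r (d + 2)) := by
      intro d
      rcases Nat.lt_or_ge d N with h | h
      · exact hlast (N - 1 - d) d (by omega)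
      · rw [typeCount_eq_zero (by omega), hsupp (d + 2) (by omega)]
        simp
    refine ⟨?_, hall⟩
    have h1 := hall 0
    obtain ⟨R, hR⟩ := exists_pathWeight_update_one (by omega : 0 < N) r
    have hRr := hR (r 1)
    rw [Function.update_eq_self] at hRr
    rcases hb : r 1 with - | b
    · have h2 := typeCount_sub_of_eq_zero (ε := ε) hm hb
      obtain ⟨hk, hl⟩ := hK.zero 0 (Nat.zero_le _) (r 2)
      rw [hb, hl] at h1
      rw [hk]
      simp only [zero_add] at h1 h2
      linear_combination h1 + h2
    · have hb3 : b ≤ 3 := by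
        have := h4 1
        omega
      have h2 := typeCount_sub_zero (ε := ε) hm hb
      obtain ⟨hp0, -⟩ := hpred 0 b (by omega) hb
      rw [hp0, hR] at h2
      rw [zero_add, Function.update_self, Function.update_of_ne (by omega)] at h2
      rw [hb] at h1 hRr
      rw [hRr] at h1 ⊢
      simp only [zero_add] at h1
      -- `IsStartWeight.first` is not assumed for the one-part type of sum `1 + ε`. That type occurs
      -- only at length `0`; here the total is larger, so its path weight vanishes.
      by_cases hex : b = ε → r 2 ≠ 0
      · linear_combination h1 + h2 - R * hK.first b hb3 (r 2) (h4 2) hex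
      · push Not at hex
        obtain ⟨rfl, hr2⟩ := hex
        have hz := pathWeight_eq_zero_of_sum hr2 (by rw [hsum, hb]; omega : r 1 < _)
        rw [hRr, hr2] at hz
        have hk := (hK.zero b le_rfl 0).1
        rw [hr2] at h1 h2 ⊢
        rw [hk] at h2
        linear_combination h1 + h2 + (L (b + 1) 0 * (1 - 1 / 2 ^ 0) - K (b + 1) 0) * hz

end

/-! ### Starting weights for the two families of shapes. -/

/-- The leading weight for the shapes `(s, s + 1, s + 1)`. -/
def unequalWeight : ℕ → ℕ → ℚ
  | 2, 0 => 3 / 4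
  | 2, 1 => 1 / 2
  | 2, 2 => 3 / 8
  | 3, 0 => 63 / 32
  | 3, 1 => 27 / 16
  | 3, 2 => 99 / 64
  | 3, 3 => 189 / 128
  | 4, 0 => 945 / 512
  | 4, 1 => 441 / 256
  | 4, 2 => 1701 / 1024
  | 4, 3 => 3339 / 2048
  | 4, 4 => 6615 / 4096
  | _, _ => 0

/-- The companion of `unequalWeight` for sequences satisfying `LastUsed`. -/
def unequalLastWeight : ℕ → ℕ → ℚ
  | 2, 1 => 1
  | 2, 2 => 1 / 2
  | 3, 1 => 9 / 4
  | 3, 2 => 15 / 8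
  | 3, 3 => 27 / 16
  | 4, 1 => 63 / 32
  | 4, 2 => 117 / 64
  | 4, 3 => 225 / 128
  | 4, 4 => 441 / 256
  | _, _ => 0

/-- The leading weight for the shapes `(s, s, s)`. -/
def equalWeight : ℕ → ℚ
  | 1 => 1
  | 2 => 21 / 4
  | 3 => 441 / 32
  | 4 => 6615 / 512
  | _ => 0

/-- The companion of `equalWeight` for sequences satisfying `LastUsed`. -/
def equalLastWeight : ℕ → ℚ
  | 1 => 2
  | 2 => 7
  | 3 => 63 / 4
  | 4 => 441 / 32
  | _ => 0

/-- The tables solve these equations recursively in the second part: `first` yields the leading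
weights for one value, then `second` the companion weights for the next. In both equations a
companion weight with second part `0` occurs only multiplied by zero. -/
theorem isStartWeight_unequal : IsStartWeight 1 unequalWeight unequalLastWeight where
  zero b hb a := by interval_cases b <;> exact ⟨rfl, rfl⟩
  one := by norm_num [unequalWeight, stepWeight, qFact, Finset.prod_range_succ]
  first b hb a ha h := by
    interval_cases b <;> interval_cases a <;>
      first
      | exact absurd rfl (h rfl)
      | norm_num [unequalWeight, unequalLastWeight, stepWeight, qFact, Finset.prod_range_succ]
  second c hc b hb a ha := by
    interval_cases c <;> interval_cases b <;> interval_cases a <;>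
      norm_num [unequalWeight, unequalLastWeight, stepWeight, qFact, Finset.prod_range_succ]

theorem isStartWeight_equal :
    IsStartWeight 0 (fun b _ => equalWeight b) (fun b _ => equalLastWeight b) where
  zero b hb a := by interval_cases b; exact ⟨rfl, rfl⟩
  one := by norm_num [equalWeight, stepWeight, qFact, Finset.prod_range_succ]
  first b hb a ha h := by
    interval_cases b <;> interval_cases a <;>
      first
      | exact absurd rfl (h rfl)
      | norm_num [equalWeight, equalLastWeight, stepWeight, qFact, Finset.prod_range_succ]
  second c hc b hb a ha := by
    interval_cases c <;> interval_cases b <;> interval_cases a <;>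
      norm_num [equalWeight, equalLastWeight, stepWeight, qFact, Finset.prod_range_succ]

/-! ### Summation over initial segments. -/

section

variable {ε N m : ℕ} {K L : ℕ → ℕ → ℚ}

theorem sum_splitType_Ico (u : ℕ → Fin 3 → ZMod 2) {d e : ℕ} (h : d ≤ e) :
    ∑ i ∈ Finset.Ico d e, splitType ε N u m (i + 1) + nullityAt ε N u m e =
      nullityAt ε N u m d := by
  induction e, h using Nat.le_induction with
  | base => simp
  | succ e h ih =>
    have := nullityAt_succ_le (ε := ε) (N := N) (u := u) (m := m) (d := e)
    rw [Finset.sum_Ico_succ_top h, ← ih, splitType]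
    omega

theorem sum_splitType (hε : ε ≤ 1) (hm : m < N) (u : ℕ → Fin 3 → ZMod 2) :
    ∑ i ∈ Finset.range N, splitType ε N u m (i + 1) = m + 1 + ε := by
  have h := sum_splitType_Ico (ε := ε) (N := N) (m := m) u (Nat.zero_le N)
  rwa [nullityAt_eq_zero hm, nullityAt_zero hε hm, Nat.Ico_zero_eq_range, add_zero] at h

theorem splitType_eq_zero (u : ℕ → Fin 3 → ZMod 2) {d : ℕ} (h : m + 1 < d) :
    splitType ε N u m d = 0 := by
  obtain ⟨e, rfl⟩ : ∃ e, d = e + 1 := ⟨d - 1, by omega⟩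
  rw [splitType, nullityAt_eq_zero (by omega), nullityAt_eq_zero (by omega)]

-- Monotonicity follows from the counting: a non-decreasing step would make the path weight zero,
-- yet `u` itself contributes to the count of its type.
open Classical in
theorem splitType_succ_le (hK : IsStartWeight ε K L) (hε : ε ≤ 1) (hm : m < N)
    (u : Fin m → Fin 3 → ZMod 2) (d : ℕ) :
    splitType ε N (seqOf u) m (d + 2) ≤ splitType ε N (seqOf u) m (d + 1) := by
  rcases Nat.lt_or_ge d N with hd | hd
  · have h := (typeCount_eq hK hε hm (r := splitType ε N (seqOf u) m) rfl splitType_le_four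
      (fun d hd => splitType_eq_zero _ (by omega)) (sum_splitType hε hm _)).1
    refine le_of_pathWeight_ne_zero (fun h0 => ?_) hd
    rw [h0, mul_zero, typeCount] at h
    have hle := Finset.single_le_sum (f := fun w : Fin m → Fin 3 → ZMod 2 =>
      if splitType ε N (seqOf w) m = splitType ε N (seqOf u) m then
        if LastUsed ε N (seqOf w) m 0 then (1 : ℚ) else 0 else 0)
      (fun w _ => by split_ifs <;> norm_num) (Finset.mem_univ u)
    rw [h, if_pos rfl, if_pos (lastUsed_zero hm)] at hle
    norm_num at hle
  · rw [splitType_eq_zero _ (by omega)]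
    exact Nat.zero_le _

theorem splitType_eq_zero_of_le (hK : IsStartWeight ε K L) (hε : ε ≤ 1) (hm : m < N)
    (u : Fin m → Fin 3 → ZMod 2) {d e : ℕ} (h : splitType ε N (seqOf u) m (d + 1) = 0)
    (hde : d ≤ e) : splitType ε N (seqOf u) m (e + 1) = 0 := by
  induction e, hde using Nat.le_induction with
  | base => exact h
  | succ e _ ih => exact Nat.le_zero.mp (ih ▸ splitType_succ_le hK hε hm u e)

open Classical in
/-- The number of sequences whose splitting type agrees with `r` beyond `D`. -/
noncomputable def suffixCount (ε N m D : ℕ) (r : ℕ → ℕ) : ℚ :=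
  ∑ u : Fin m → Fin 3 → ZMod 2,
    if ∀ i, D < i → splitType ε N (seqOf u) m i = r i then 1 else 0

/-- `F` counts the initial segments of splitting types. -/
def IsLowerSum (ε N m D : ℕ) (F : ℕ → ℕ → ℚ) : Prop :=
  ∀ r : ℕ → ℕ, (∀ i, r i ≤ 4) → (∀ i, N < i → r i = 0) → ∀ j,
    j + ∑ e ∈ Finset.Ico (D + 1) N, r (e + 1) = m + 1 + ε →
    suffixCount ε N m D r =
      F (r (D + 1)) j * ∏ e ∈ Finset.Ico D N, stepWeight (r (e + 1)) (r (e + 2))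

theorem suffixCount_eq_zero (hε : ε ≤ 1) (hm : m < N) {D : ℕ} {r : ℕ → ℕ}
    (h : m + 1 + ε < ∑ e ∈ Finset.Ico D N, r (e + 1)) : suffixCount ε N m D r = 0 := by
  refine Finset.sum_eq_zero fun u _ => if_neg fun hu => ?_
  have h1 := sum_splitType hε hm (seqOf u)
  have h2 : ∑ e ∈ Finset.Ico D N, r (e + 1) ≤ m + 1 + ε := by
    rw [← h1, Finset.range_eq_Ico]
    calc _ = ∑ e ∈ Finset.Ico D N, splitType ε N (seqOf u) m (e + 1) :=
          Finset.sum_congr rfl fun e he =>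
            (hu _ (Nat.lt_succ_of_le (Finset.mem_Ico.mp he).1)).symm
      _ ≤ _ := Finset.sum_le_sum_of_subset (Finset.Ico_subset_Ico_left (Nat.zero_le _))
  omega

theorem suffixCount_zero (hK : IsStartWeight ε K L) (hε : ε ≤ 1) (hm : m < N) {r : ℕ → ℕ}
    (h4 : ∀ i, r i ≤ 4) (hsupp : ∀ i, N < i → r i = 0) {j : ℕ}
    (hj : j + ∑ e ∈ Finset.Ico 1 N, r (e + 1) = m + 1 + ε) :
    suffixCount ε N m 0 r = if j = r 1 then K (r 1) (r 2) * pathWeight N r else 0 := by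
  have hsum : ∑ e ∈ Finset.range N, r (e + 1) = r 1 + ∑ e ∈ Finset.Ico 1 N, r (e + 1) := by
    rw [Finset.range_eq_Ico, Finset.sum_eq_sum_Ico_succ_bot (by omega)]
  split_ifs with h
  -- Entry `0` of a splitting type is `4` by convention, whereas `r 0` is arbitrary here and has to
  -- be overwritten.
  · have hr : ∀ i, Function.update r 0 4 (i + 1) = r (i + 1) := fun i =>
      Function.update_of_ne (by omega) _ _
    have := (typeCount_eq hK hε hm (r := Function.update r 0 4) (by simp) (fun i => by
      rw [Function.update_apply]
      split_ifs
      exacts [le_rfl, h4 i]) (fun i hi => by rw [Function.update_of_ne (by omega), hsupp i hi])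
      (by simp only [hr]; omega)).1
    simp only [pathWeight, hr] at this
    rw [pathWeight, ← this, suffixCount, typeCount]
    refine Finset.sum_congr rfl fun u _ => ?_
    rw [if_pos (lastUsed_zero hm)]
    congr 1
    rw [eq_iff_iff]
    constructor
    · intro hu
      funext i
      rcases i with - | i
      · rw [Function.update_self]
        rfl
      · rw [hr, hu _ (Nat.succ_pos i)]
    · intro hu i hi
      rw [hu, Function.update_of_ne (by omega)]
  · refine Finset.sum_eq_zero fun u _ => if_neg fun hu => h ?_
    have h1 := sum_splitType hε hm (seqOf u)
    rw [Finset.sum_congr rfl fun e _ => hu (e + 1) (Nat.succ_pos e)] at h1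
    omega

theorem suffixCount_succ (D : ℕ) (r : ℕ → ℕ) :
    suffixCount ε N m (D + 1) r =
      ∑ x ∈ Finset.range 5, suffixCount ε N m D (Function.update r (D + 1) x) := by
  simp only [suffixCount]
  rw [Finset.sum_comm]
  refine Finset.sum_congr rfl fun u _ => ?_
  rw [Finset.sum_eq_single_of_mem (splitType ε N (seqOf u) m (D + 1))
    (Finset.mem_range.mpr (Nat.lt_succ_of_le (splitType_le_four _)))]
  · congr 1
    rw [eq_iff_iff]
    constructor
    · intro h i hi
      rcases Nat.eq_or_lt_of_le (Nat.succ_le_of_lt hi) with h' | h'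
      · rw [← h', Nat.succ_eq_add_one, Function.update_self]
      · rw [Function.update_of_ne (by omega), h i h']
    · intro h i hi
      rw [h i (by omega), Function.update_of_ne (by omega)]
  · intro x _ hx
    refine if_neg fun h => hx ?_
    rw [h (D + 1) (by omega), Function.update_self]

/-- The transfer step for the weights of initial segments of conjugate partitions. -/
def lowerStep (F : ℕ → ℕ → ℚ) (ρ j : ℕ) : ℚ :=
  if ρ ≤ j then ∑ x ∈ Finset.range 5, F x (j - ρ) * stepWeight x ρ else 0

/-- In `F ρ j` the number `j` is the sum of the first `D + 1` parts and `ρ` the last of them.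
Summing over the part before `ρ` lengthens the segment by one. -/
theorem IsLowerSum.succ (hε : ε ≤ 1) (hm : m < N) {D : ℕ} (hD : D + 1 < N) {F : ℕ → ℕ → ℚ}
    (hF : IsLowerSum ε N m D F) : IsLowerSum ε N m (D + 1) (lowerStep F) := by
  intro r h4 hsupp j hj
  have hS : ∑ e ∈ Finset.Ico (D + 1) N, r (e + 1) =
      r (D + 2) + ∑ e ∈ Finset.Ico (D + 2) N, r (e + 1) := Finset.sum_eq_sum_Ico_succ_bot hD _
  change suffixCount ε N m (D + 1) r = lowerStep F (r (D + 2)) j * _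
  change j + ∑ e ∈ Finset.Ico (D + 2) N, r (e + 1) = m + 1 + ε at hj
  rw [lowerStep]
  split_ifs with hle
  · rw [suffixCount_succ, Finset.sum_mul]
    refine Finset.sum_congr rfl fun x hx => ?_
    have hr : ∀ i, D + 1 ≤ i → Function.update r (D + 1) x (i + 1) = r (i + 1) := fun i hi =>
      Function.update_of_ne (by omega) _ _
    have h4' : ∀ i, Function.update r (D + 1) x i ≤ 4 := fun i => by
      rw [Function.update_apply]
      split_ifs
      · have := Finset.mem_range.mp hx
        omega
      · exact h4 i
    have hsupp' : ∀ i, N < i → Function.update r (D + 1) x i = 0 := fun i hi => by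
      rw [Function.update_of_ne (by omega), hsupp i hi]
    have hsum' : j - r (D + 2) +
        ∑ e ∈ Finset.Ico (D + 1) N, Function.update r (D + 1) x (e + 1) = m + 1 + ε := by
      rw [Finset.sum_congr rfl fun e he => hr e (Finset.mem_Ico.mp he).1, hS]
      omega
    rw [hF _ h4' hsupp' _ hsum', Function.update_self,
      Finset.prod_eq_prod_Ico_succ_bot (by omega), Function.update_self, hr _ le_rfl, mul_assoc]
    congr 2
    refine Finset.prod_congr rfl fun e he => ?_
    rw [hr e (Finset.mem_Ico.mp he).1, hr (e + 1) (by have := (Finset.mem_Ico.mp he).1; omega)]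
  · rw [zero_mul]
    refine suffixCount_eq_zero hε hm ?_
    rw [hS]
    omega

theorem isLowerSum_zero {K L : ℕ → ℚ} (hK : IsStartWeight ε (fun b _ => K b) fun b _ => L b)
    (hε : ε ≤ 1) (hm : m < N) :
    IsLowerSum ε N m 0 fun ρ j => if j = ρ then K ρ else 0 := by
  intro r h4 hsupp j hj
  rw [suffixCount_zero hK hε hm h4 hsupp hj, zero_add, ite_mul, zero_mul, pathWeight,
    Finset.range_eq_Ico]

/-- The leading weight may involve two parts, so the recursion starts after the second. The sum `j`
of the two then determines the first as `j - ρ`. -/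
theorem isLowerSum_one (hK : IsStartWeight ε K L) (hε : ε ≤ 1) (hm : m < N) (hN : 1 < N) :
    IsLowerSum ε N m 1 fun ρ j =>
      if ρ ≤ j ∧ j - ρ ≤ 4 then K (j - ρ) ρ * stepWeight (j - ρ) ρ else 0 := by
  intro r h4 hsupp j hj
  have hS : ∑ e ∈ Finset.Ico 1 N, r (e + 1) = r 2 + ∑ e ∈ Finset.Ico 2 N, r (e + 1) :=
    Finset.sum_eq_sum_Ico_succ_bot hN _
  change suffixCount ε N m 1 r =
    (if r 2 ≤ j ∧ j - r 2 ≤ 4 then K (j - r 2) (r 2) * stepWeight (j - r 2) (r 2) else 0) * _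
  change j + ∑ e ∈ Finset.Ico 2 N, r (e + 1) = m + 1 + ε at hj
  have hr : ∀ x i, 1 ≤ i → Function.update r 1 x (i + 1) = r (i + 1) := fun x i hi =>
    Function.update_of_ne (by omega) _ _
  by_cases hle : r 2 ≤ j
  · have hterm : ∀ x ∈ Finset.range 5, suffixCount ε N m 0 (Function.update r 1 x) =
        if x = j - r 2 then K (j - r 2) (r 2) * pathWeight N (Function.update r 1 (j - r 2))
        else 0 := by
      intro x hx
      have h4' : ∀ i, Function.update r 1 x i ≤ 4 := fun i => by
        rw [Function.update_apply]
        split_ifs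
        · have := Finset.mem_range.mp hx
          omega
        · exact h4 i
      have hsupp' : ∀ i, N < i → Function.update r 1 x i = 0 := fun i hi => by
        rw [Function.update_of_ne (by omega), hsupp i hi]
      have hsum' : j - r 2 + ∑ e ∈ Finset.Ico 1 N, Function.update r 1 x (e + 1) =
          m + 1 + ε := by
        rw [Finset.sum_congr rfl fun e he => hr x e (Finset.mem_Ico.mp he).1, hS]
        omega
      rw [suffixCount_zero hK hε hm h4' hsupp' hsum', Function.update_self, hr x 1 le_rfl]
      by_cases h : x = j - r 2
      · rw [if_pos h.symm, if_pos h, ← h]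
      · rw [if_neg (Ne.symm h), if_neg h]
    rw [suffixCount_succ 0, zero_add, Finset.sum_congr rfl hterm, Finset.sum_ite_eq']
    simp only [Finset.mem_range]
    by_cases h : j - r 2 ≤ 4
    · rw [if_pos (by omega), if_pos ⟨hle, h⟩, pathWeight, Finset.range_eq_Ico,
        Finset.prod_eq_prod_Ico_succ_bot (by omega), zero_add,
        Function.update_self, hr _ 1 le_rfl, mul_assoc]
      congr 2
      refine Finset.prod_congr rfl fun e he => ?_
      rw [hr _ e (Finset.mem_Ico.mp he).1, hr _ (e + 1) (by omega)]
    · rw [if_neg (by omega), if_neg fun h' => h h'.2, zero_mul]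
  · rw [if_neg fun h => hle h.1, zero_mul]
    refine suffixCount_eq_zero hε hm ?_
    rw [hS]
    omega

end

/-! ### Summation over final segments. -/

/-- The total weight of the final segments of sum `n` following a part `ρ`. -/
def upperSum (ρ n : ℕ) : ℚ :=
  match ρ with
  | 0 => if n = 0 then 1 else 0
  | 1 => 1
  | 2 => 4 * (2 * 2 ^ n - 1) / 3
  | 3 => 64 * (2 * 2 ^ n - 1) * (4 * 2 ^ n - 1) / 63
  | 4 => 4096 * (2 * 2 ^ n - 1) * (4 * 2 ^ n - 1) * (8 * 2 ^ n - 1) / 6615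
  | _ => 0

theorem upperSum_zero {ρ : ℕ} (h : ρ ≤ 4) : upperSum ρ 0 = stepWeight ρ 0 := by
  interval_cases ρ <;> norm_num [upperSum, stepWeight, qFact, Finset.prod_range_succ]

/-- Splitting off the next part. From `n = 5` on the condition `x ≤ n` is automatic and the claim is
a polynomial identity in a power of two; smaller `n` are evaluated. -/
theorem upperSum_eq {ρ n : ℕ} (h : ρ ≤ 4) (hn : 0 < n) : upperSum ρ n =
    ∑ x ∈ Finset.range 5,
      if 0 < x ∧ x ≤ n then stepWeight ρ x * upperSum x (n - x) else 0 := by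
  rcases Nat.lt_or_ge n 5 with h5 | h5
  · interval_cases n <;> interval_cases ρ <;>
      norm_num [upperSum, stepWeight, qFact, Finset.prod_range_succ, Finset.sum_range_succ]
  · obtain ⟨k, rfl⟩ : ∃ k, n = k + 4 := ⟨n - 4, by omega⟩
    have hk : k ≠ 0 := by omega
    simp only [Finset.sum_range_succ, Finset.sum_range_zero, show k + 4 - 1 = k + 3 by omega,
      show k + 4 - 2 = k + 2 by omega, show k + 4 - 3 = k + 1 by omega,
      show k + 4 - 4 = k by omega, show 1 ≤ k + 4 by omega, show 2 ≤ k + 4 by omega,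
      show 3 ≤ k + 4 by omega, show 4 ≤ k + 4 by omega]
    interval_cases ρ <;>
      norm_num [upperSum, stepWeight, qFact, Finset.prod_range_succ] <;> ring

section

variable {ε N m : ℕ} {K L : ℕ → ℕ → ℚ}

open Classical in
/-- The number of sequences whose splitting type agrees with `r` strictly above `D` and up to `e`
and whose nullity at `e` is `n`. -/
noncomputable def segmentCount (ε N m D e : ℕ) (r : ℕ → ℕ) (n : ℕ) : ℚ :=
  ∑ u : Fin m → Fin 3 → ZMod 2,
    if (∀ i, D < i → i ≤ e → splitType ε N (seqOf u) m i = r i) ∧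
      nullityAt ε N (seqOf u) m e = n then 1 else 0

theorem nullityAt_anti (u : ℕ → Fin 3 → ZMod 2) {d e : ℕ} (h : d ≤ e) :
    nullityAt ε N u m e ≤ nullityAt ε N u m d := by
  induction e, h using Nat.le_induction with
  | base => exact le_rfl
  | succ e _ ih => exact nullityAt_succ_le.trans ih

theorem segmentCount_zero (hm : m < N) {D e : ℕ} (he : D < e) (r : ℕ → ℕ) :
    segmentCount ε N m D e r 0 =
      suffixCount ε N m D fun i => if i ≤ e then r i else 0 := by
  refine Finset.sum_congr rfl fun u _ => ?_
  congr 1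
  rw [eq_iff_iff]
  constructor
  · rintro ⟨h1, h2⟩ i hi
    dsimp only
    split_ifs with hie
    · exact h1 i hi hie
    · obtain ⟨i, rfl⟩ : ∃ k, i = k + 1 := ⟨i - 1, by omega⟩
      have := nullityAt_anti (ε := ε) (N := N) (m := m) (seqOf u) (show e ≤ i by omega)
      rw [splitType]
      omega
  · intro h
    refine ⟨fun i hi hie => (h i hi).trans (if_pos hie), ?_⟩
    rcases Nat.lt_or_ge e N with heN | heN
    · rw [← sum_splitType_Ico (seqOf u) heN.le, nullityAt_eq_zero hm, add_zero]
      refine Finset.sum_eq_zero fun i hi => ?_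
      have := (Finset.mem_Ico.mp hi).1
      exact (h (i + 1) (by omega)).trans (if_neg (by omega))
    · exact nullityAt_eq_zero (by omega)

/-- The nullity is the sum of the remaining parts. If it is positive, so is the next part, since
after a zero part all parts are zero. -/
theorem segmentCount_step (hK : IsStartWeight ε K L) (hε : ε ≤ 1) (hm : m < N) {D e n : ℕ}
    (he : D ≤ e) (hn : 0 < n) (r : ℕ → ℕ) :
    segmentCount ε N m D (e + 1) r n = ∑ x ∈ Finset.range 5, if 0 < x ∧ x ≤ n then
      segmentCount ε N m D (e + 2) (Function.update r (e + 2) x) (n - x) else 0 := by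
  classical
  have hswap : ∀ x, (if 0 < x ∧ x ≤ n then
      segmentCount ε N m D (e + 2) (Function.update r (e + 2) x) (n - x) else 0) =
      ∑ u : Fin m → Fin 3 → ZMod 2, if (0 < x ∧ x ≤ n) ∧
        (∀ i, D < i → i ≤ e + 2 →
          splitType ε N (seqOf u) m i = Function.update r (e + 2) x i) ∧
        nullityAt ε N (seqOf u) m (e + 2) = n - x then 1 else 0 := by
    intro x
    by_cases h : 0 < x ∧ x ≤ n
    · rw [if_pos h, segmentCount]
      refine Finset.sum_congr rfl fun u _ => ?_
      congr 1
      rw [eq_iff_iff]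
      exact ⟨fun h' => ⟨h, h'⟩, fun h' => h'.2⟩
    · rw [if_neg h]
      exact (Finset.sum_eq_zero fun u _ => if_neg fun h' => h h'.1).symm
  rw [Finset.sum_congr rfl fun x _ => hswap x, Finset.sum_comm, segmentCount]
  refine Finset.sum_congr rfl fun u _ => ?_
  have hanti : nullityAt ε N (seqOf u) m (e + 2) ≤ nullityAt ε N (seqOf u) m (e + 1) :=
    nullityAt_succ_le
  have hT : splitType ε N (seqOf u) m (e + 2) =
    nullityAt ε N (seqOf u) m (e + 1) - nullityAt ε N (seqOf u) m (e + 2) := rfl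
  rw [Finset.sum_eq_single_of_mem (splitType ε N (seqOf u) m (e + 2))
    (Finset.mem_range.mpr (Nat.lt_succ_of_le (splitType_le_four _)))]
  · congr 1
    rw [eq_iff_iff]
    constructor
    · rintro ⟨h1, h2⟩
      refine ⟨⟨Nat.pos_of_ne_zero fun h0 => ?_, by omega⟩, fun i hi hie => ?_, by omega⟩
      · rcases Nat.lt_or_ge (e + 1) N with heN | heN
        · rw [← sum_splitType_Ico (seqOf u) heN.le, nullityAt_eq_zero hm, add_zero,
            Finset.sum_eq_zero fun i hi =>
              splitType_eq_zero_of_le hK hε hm u h0 (Finset.mem_Ico.mp hi).1] at h2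
          omega
        · rw [nullityAt_eq_zero (by omega)] at h2
          omega
      · rcases Nat.eq_or_lt_of_le hie with rfl | h
        · rw [Function.update_self]
        · rw [Function.update_of_ne (by omega), h1 i hi (by omega)]
    · rintro ⟨⟨h1, h2⟩, h3, h4⟩
      refine ⟨fun i hi hie => ?_, by omega⟩
      rw [h3 i hi (by omega), Function.update_of_ne (by omega)]
  · intro x _ hx
    refine if_neg fun h => hx ?_
    rw [h.2.1 (e + 2) (by omega) le_rfl, Function.update_self]

theorem segmentCount_eq (hK : IsStartWeight ε K L) (hε : ε ≤ 1) (hm : m < N) {D : ℕ}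
    {F : ℕ → ℕ → ℚ} (hF : IsLowerSum ε N m D F) (n : ℕ) : ∀ e, D ≤ e → e + 1 + n ≤ N →
    ∀ r : ℕ → ℕ, (∀ i, r i ≤ 4) → ∀ j,
      j + ∑ i ∈ Finset.Ico (D + 1) (e + 1), r (i + 1) + n = m + 1 + ε →
      segmentCount ε N m D (e + 1) r n = F (r (D + 1)) j *
        (∏ i ∈ Finset.Ico D e, stepWeight (r (i + 1)) (r (i + 2))) * upperSum (r (e + 1)) n := by
  induction n using Nat.strong_induction_on with
  | _ n ih =>
    intro e he heN r h4 j hj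
    rcases Nat.eq_zero_or_pos n with rfl | hn
    · have h4' : ∀ i, (if i ≤ e + 1 then r i else 0) ≤ 4 := fun i => by
        split_ifs
        exacts [h4 i, Nat.zero_le _]
      have hsum : j + ∑ i ∈ Finset.Ico (D + 1) N, (if i + 1 ≤ e + 1 then r (i + 1) else 0) =
          m + 1 + ε := by
        have h1 : ∑ i ∈ Finset.Ico (D + 1) (e + 1), (if i + 1 ≤ e + 1 then r (i + 1) else 0) =
            ∑ i ∈ Finset.Ico (D + 1) (e + 1), r (i + 1) :=
          Finset.sum_congr rfl fun i hi => if_pos (Finset.mem_Ico.mp hi).2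
        have h2 : ∑ i ∈ Finset.Ico (e + 1) N, (if i + 1 ≤ e + 1 then r (i + 1) else 0) = 0 :=
          Finset.sum_eq_zero fun i hi => if_neg (by
            have := (Finset.mem_Ico.mp hi).1
            omega)
        rw [← Finset.sum_Ico_consecutive _ (show D + 1 ≤ e + 1 by omega)
          (show e + 1 ≤ N by omega), h1, h2, ← hj, add_assoc]
      have hprod : ∏ i ∈ Finset.Ico D N, stepWeight (if i + 1 ≤ e + 1 then r (i + 1) else 0)
          (if i + 2 ≤ e + 1 then r (i + 2) else 0) =
          (∏ i ∈ Finset.Ico D e, stepWeight (r (i + 1)) (r (i + 2))) *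
            stepWeight (r (e + 1)) 0 := by
        rw [← Finset.prod_Ico_consecutive _ he (show e ≤ N by omega),
          Finset.prod_eq_prod_Ico_succ_bot (show e < N by omega), if_pos le_rfl,
          if_neg (show ¬ e + 2 ≤ e + 1 by omega), Finset.prod_eq_one (s := Finset.Ico (e + 1) N),
          mul_one]
        · congr 1
          refine Finset.prod_congr rfl fun i hi => ?_
          have := (Finset.mem_Ico.mp hi).2
          rw [if_pos (by omega), if_pos (by omega)]
        · intro i hi
          have := (Finset.mem_Ico.mp hi).1
          rw [if_neg (by omega), if_neg (by omega)]
          norm_num [stepWeight, qFact]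
      rw [segmentCount_zero hm (by omega), hF _ h4' (fun i hi => if_neg (by omega)) j hsum, hprod,
        upperSum_zero (h4 _), if_pos (by omega), mul_assoc]
    · rw [segmentCount_step hK hε hm he hn, upperSum_eq (h4 _) hn, Finset.mul_sum]
      refine Finset.sum_congr rfl fun x hx => ?_
      split_ifs with hxn
      · have hr : ∀ i, i ≤ e + 1 → Function.update r (e + 2) x i = r i := fun i hi =>
          Function.update_of_ne (by omega) _ _
        have hsum : j + ∑ i ∈ Finset.Ico (D + 1) (e + 2), Function.update r (e + 2) x (i + 1) +
            (n - x) = m + 1 + ε := by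
          rw [Finset.sum_Ico_succ_top (by omega), Function.update_self,
            Finset.sum_congr rfl fun i hi => hr (i + 1) (by
              have := (Finset.mem_Ico.mp hi).2
              omega)]
          omega
        have h4' : ∀ i, Function.update r (e + 2) x i ≤ 4 := fun i => by
          rw [Function.update_apply]
          split_ifs
          · have := Finset.mem_range.mp hx
            omega
          · exact h4 i
        rw [ih (n - x) (by omega) (e + 1) (by omega) (by omega) _ h4' j hsum,
          Finset.prod_Ico_succ_top he, hr _ (by omega), hr _ le_rfl,
          show e + 1 + 1 = e + 2 from rfl, Function.update_self,
          Finset.prod_congr rfl fun i hi => by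
            have := (Finset.mem_Ico.mp hi).2
            rw [hr (i + 1) (by omega), hr (i + 2) (by omega)]]
        ring
      · rw [mul_zero]

-- Classify by part `D + 1`, with value `ρ`: the parts up to it sum to `j`, those after it to `n`,
-- and the weight factors accordingly.
open Classical in
theorem sum_nullityAt_eq (hK : IsStartWeight ε K L) (hε : ε ≤ 1) (hm : m < N) {D n j : ℕ}
    {F : ℕ → ℕ → ℚ} (hF : IsLowerSum ε N m D F) (hN : D + 1 + n ≤ N) (hj : j + n = m + 1 + ε) :
    ∑ u : Fin m → Fin 3 → ZMod 2,
      (if nullityAt ε N (seqOf u) m (D + 1) = n then (1 : ℚ) else 0) =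
      ∑ ρ ∈ Finset.range 5, F ρ j * upperSum ρ n := by
  have h : ∀ ρ ∈ Finset.range 5, F ρ j * upperSum ρ n =
      segmentCount ε N m D (D + 1) (fun _ => ρ) n := by
    intro ρ hρ
    rw [segmentCount_eq hK hε hm hF n D le_rfl hN _ (fun _ => by
      have := Finset.mem_range.mp hρ
      omega) j (by simpa using hj)]
    simp
  rw [Finset.sum_congr rfl h]
  simp only [segmentCount]
  rw [Finset.sum_comm]
  refine Finset.sum_congr rfl fun u _ => ?_
  rw [Finset.sum_eq_single_of_mem (splitType ε N (seqOf u) m (D + 1))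
    (Finset.mem_range.mpr (Nat.lt_succ_of_le (splitType_le_four _)))]
  · congr 1
    rw [eq_iff_iff]
    refine ⟨fun h => ⟨fun i hi hi' => ?_, h⟩, fun h => h.2⟩
    rw [show i = D + 1 by omega]
  · intro x _ hx
    exact if_neg fun h => hx (h.1 (D + 1) (by omega) le_rfl).symm

end

/-! ### Closed forms of the initial sums. -/

/-- The closed forms of the weights of initial segments for the shapes `(s, s + 1, s + 1)`. -/
structure IsLowerClosed (d : ℕ) (G : ℕ → ℕ → ℚ) : Prop where
  four_eq : ∀ j, j = 4 * d → G 4 j = 6615 / 16777216 * (2 ^ d) ^ 12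
  four_ne : ∀ j, j ≠ 4 * d → G 4 j = 0
  three_lt : ∀ j, j < 3 * d → G 3 j = 0
  three_zero : ∀ j, j = 3 * d → G 3 j = 189 / 8192 * (2 ^ d) ^ 6
  three_one : ∀ j, j = 3 * d + 1 → G 3 j = 3339 / 2048 * (2 ^ d) ^ 6
  three_mid : ∀ j, 3 * d + 2 ≤ j → j < 4 * d →
    G 3 j = 6615 / 262144 * ((2 ^ j) ^ 6 / (2 ^ d) ^ 12)
  three_top : ∀ j, 4 * d ≤ j → G 3 j = 0
  two_lt : ∀ j, j < 2 * d → G 2 j = 0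
  two_zero : ∀ j, j = 2 * d → G 2 j = 3 / 32 * (2 ^ d) ^ 2
  two_one : ∀ j, j = 2 * d + 1 → G 2 j = 99 / 16 * (2 ^ d) ^ 2
  two_mid : ∀ j, 2 * d + 2 ≤ j → j < 3 * d →
    G 2 j = 2205 / 8192 * ((2 ^ j) ^ 5 / (2 ^ d) ^ 8) - 315 / 2048 * ((2 ^ j) ^ 4 / (2 ^ d) ^ 6)
  two_three : ∀ j, j = 3 * d →
    G 2 j = 2205 / 8192 * (2 ^ d) ^ 7 - 1071 / 2048 * (2 ^ d) ^ 6
  two_high : ∀ j, 3 * d < j → j < 4 * d →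
    G 2 j = 2205 / 8192 * ((2 ^ j) ^ 5 / (2 ^ d) ^ 8) - 2205 / 4096 * ((2 ^ j) ^ 6 / (2 ^ d) ^ 12)
  two_top : ∀ j, 4 * d ≤ j → G 2 j = 0
  one_lt : ∀ j, j ≤ d → G 1 j = 0
  one_one : ∀ j, j = d + 1 → G 1 j = 2
  one_mid : ∀ j, d + 2 ≤ j → j < 2 * d →
    G 1 j = 105 / 512 * ((2 ^ j) ^ 4 / (2 ^ d) ^ 4) - 21 / 128 * ((2 ^ j) ^ 3 / (2 ^ d) ^ 3)
  one_two : ∀ j, j = 2 * d →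
    G 1 j = 105 / 512 * (2 ^ d) ^ 4 - 21 / 128 * (2 ^ d) ^ 3 - 3 / 8 * (2 ^ d) ^ 2
  one_high : ∀ j, 2 * d < j → j < 3 * d →
    G 1 j = 105 / 512 * ((2 ^ j) ^ 4 / (2 ^ d) ^ 4) - 21 / 128 * ((2 ^ j) ^ 3 / (2 ^ d) ^ 3) -
      315 / 256 * ((2 ^ j) ^ 5 / (2 ^ d) ^ 8) + 105 / 128 * ((2 ^ j) ^ 4 / (2 ^ d) ^ 6)
  one_last : ∀ j, 3 * d ≤ j → j < 4 * d →
    G 1 j = 105 / 512 * ((2 ^ j) ^ 4 / (2 ^ d) ^ 4) - 315 / 256 * ((2 ^ j) ^ 5 / (2 ^ d) ^ 8) +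
      105 / 64 * ((2 ^ j) ^ 6 / (2 ^ d) ^ 12)
  one_top : ∀ j, 4 * d ≤ j → G 1 j = 0
  nil_low : ∀ j, d < j → j < 2 * d →
    G 0 j = 1 / 64 * (2 ^ j) ^ 3 - 7 / 32 * ((2 ^ j) ^ 4 / (2 ^ d) ^ 4) +
      3 / 16 * ((2 ^ j) ^ 3 / (2 ^ d) ^ 3)
  nil_mid : ∀ j, 2 * d ≤ j → j < 3 * d →
    G 0 j = 1 / 64 * (2 ^ j) ^ 3 - 7 / 32 * ((2 ^ j) ^ 4 / (2 ^ d) ^ 4) +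
      3 / 16 * ((2 ^ j) ^ 3 / (2 ^ d) ^ 3) + 7 / 8 * ((2 ^ j) ^ 5 / (2 ^ d) ^ 8) -
      5 / 8 * ((2 ^ j) ^ 4 / (2 ^ d) ^ 6)
  nil_high : ∀ j, 3 * d ≤ j + 1 → j < 4 * d →
    G 0 j = 1 / 64 * (2 ^ j) ^ 3 - 7 / 32 * ((2 ^ j) ^ 4 / (2 ^ d) ^ 4) +
      7 / 8 * ((2 ^ j) ^ 5 / (2 ^ d) ^ 8) - (2 ^ j) ^ 6 / (2 ^ d) ^ 12
  nil_top : ∀ j, 4 * d ≤ j → G 0 j = 0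

section

variable {G : ℕ → ℕ → ℚ} {d j : ℕ}

theorem lowerStep_of_lt {ρ : ℕ} (h : j < ρ) : lowerStep G ρ j = 0 := if_neg h.not_ge

theorem lowerStep_zero : lowerStep G 0 j =
    G 0 j + G 1 j + 4 / 3 * G 2 j + 64 / 21 * G 3 j + 4096 / 315 * G 4 j := by
  norm_num [lowerStep, stepWeight, qFact, Finset.sum_range_succ, Finset.prod_range_succ]
  ring

theorem lowerStep_one : lowerStep G 1 (j + 1) =
    G 1 j + 4 * G 2 j + 64 / 3 * G 3 j + 4096 / 21 * G 4 j := by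
  norm_num [lowerStep, stepWeight, qFact, Finset.sum_range_succ, Finset.prod_range_succ]
  ring

theorem lowerStep_two : lowerStep G 2 (j + 2) =
    4 * G 2 j + 64 * G 3 j + 4096 / 3 * G 4 j := by
  norm_num [lowerStep, stepWeight, qFact, Finset.sum_range_succ, Finset.prod_range_succ]
  ring

theorem lowerStep_three : lowerStep G 3 (j + 3) = 64 * G 3 j + 4096 * G 4 j := by
  norm_num [lowerStep, stepWeight, qFact, Finset.sum_range_succ, Finset.prod_range_succ]
  ring

theorem lowerStep_four : lowerStep G 4 (j + 4) = 4096 * G 4 j := by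
  norm_num [lowerStep, stepWeight, qFact, Finset.sum_range_succ, Finset.prod_range_succ]
  ring

/-- A last part `ρ` forces all `d` parts into `[ρ, 4]`, so sums lie between `ρ * d` and `4 * d`, and
the formulas change at multiples of `d`. Passing to `d + 1` moves these thresholds, so each range
for `d + 1` also draws on a few boundary values for `d`, treated separately. -/
theorem IsLowerClosed.succ (hd : 2 ≤ d) (h : IsLowerClosed d G) :
    IsLowerClosed (d + 1) (lowerStep G) where
  four_eq j hj := by
    obtain ⟨i, rfl⟩ : ∃ i, j = i + 4 := ⟨j - 4, by omega⟩
    rw [lowerStep_four, h.four_eq i (by omega)]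
    ring
  four_ne j hj := by
    rcases Nat.lt_or_ge j 4 with h4 | h4
    · exact lowerStep_of_lt h4
    obtain ⟨i, rfl⟩ : ∃ i, j = i + 4 := ⟨j - 4, by omega⟩
    rw [lowerStep_four, h.four_ne i (by omega), mul_zero]
  three_lt j hj := by
    rcases Nat.lt_or_ge j 3 with h4 | h4
    · exact lowerStep_of_lt h4
    obtain ⟨i, rfl⟩ : ∃ i, j = i + 3 := ⟨j - 3, by omega⟩
    rw [lowerStep_three, h.three_lt i (by omega), h.four_ne i (by omega)]
    ring
  three_zero j hj := by
    obtain ⟨i, rfl⟩ : ∃ i, j = i + 3 := ⟨j - 3, by omega⟩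
    rw [lowerStep_three, h.three_zero i (by omega), h.four_ne i (by omega)]
    ring
  three_one j hj := by
    obtain ⟨i, rfl⟩ : ∃ i, j = i + 3 := ⟨j - 3, by omega⟩
    rw [lowerStep_three, h.three_one i (by omega), h.four_ne i (by omega)]
    ring
  three_mid j hj hj' := by
    obtain ⟨i, rfl⟩ : ∃ i, j = i + 3 := ⟨j - 3, by omega⟩
    rcases Nat.lt_or_ge i (4 * d) with hi | hi
    · rw [lowerStep_three, h.three_mid i (by omega) hi, h.four_ne i (by omega)]
      simp only [pow_succ (2 : ℚ) d, pow_add (2 : ℚ) i]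
      field
    · obtain rfl : i = 4 * d := by omega
      rw [lowerStep_three, h.three_top _ (by omega), h.four_eq _ rfl]
      simp only [pow_succ (2 : ℚ) d, pow_add (2 : ℚ) (4 * d), pow_mul' (2 : ℚ) 4 d]
      field
  three_top j hj := by
    obtain ⟨i, rfl⟩ : ∃ i, j = i + 3 := ⟨j - 3, by omega⟩
    rw [lowerStep_three, h.three_top i (by omega), h.four_ne i (by omega)]
    ring
  two_lt j hj := by
    rcases Nat.lt_or_ge j 2 with h4 | h4
    · exact lowerStep_of_lt h4
    obtain ⟨i, rfl⟩ : ∃ i, j = i + 2 := ⟨j - 2, by omega⟩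
    rw [lowerStep_two, h.two_lt i (by omega), h.three_lt i (by omega), h.four_ne i (by omega)]
    ring
  two_zero j hj := by
    obtain ⟨i, rfl⟩ : ∃ i, j = i + 2 := ⟨j - 2, by omega⟩
    rw [lowerStep_two, h.two_zero i (by omega), h.three_lt i (by omega), h.four_ne i (by omega)]
    ring
  two_one j hj := by
    obtain ⟨i, rfl⟩ : ∃ i, j = i + 2 := ⟨j - 2, by omega⟩
    rw [lowerStep_two, h.two_one i (by omega), h.three_lt i (by omega), h.four_ne i (by omega)]
    ring
  two_mid j hj hj' := by
    obtain ⟨i, rfl⟩ : ∃ i, j = i + 2 := ⟨j - 2, by omega⟩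
    rcases Nat.lt_or_ge i (3 * d) with hi | hi
    · rw [lowerStep_two, h.two_mid i (by omega) hi, h.three_lt i (by omega),
        h.four_ne i (by omega)]
      simp only [pow_succ (2 : ℚ) d, pow_add (2 : ℚ) i]
      field
    · obtain rfl : i = 3 * d := by omega
      rw [lowerStep_two, h.two_three _ rfl, h.three_zero _ rfl, h.four_ne _ (by omega)]
      simp only [pow_succ (2 : ℚ) d, pow_add (2 : ℚ) (3 * d), pow_mul' (2 : ℚ) 3 d]
      field
  two_three j hj := by
    obtain ⟨i, rfl⟩ : ∃ i, j = i + 2 := ⟨j - 2, by omega⟩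
    obtain rfl : i = 3 * d + 1 := by omega
    rw [lowerStep_two, h.two_high _ (by omega) (by omega), h.three_one _ rfl,
      h.four_ne _ (by omega)]
    simp only [pow_succ (2 : ℚ) d, pow_add (2 : ℚ) (3 * d), pow_mul' (2 : ℚ) 3 d]
    field
  two_high j hj hj' := by
    obtain ⟨i, rfl⟩ : ∃ i, j = i + 2 := ⟨j - 2, by omega⟩
    rcases lt_trichotomy i (4 * d) with hi | rfl | hi
    · rw [lowerStep_two, h.two_high i (by omega) hi, h.three_mid i (by omega) hi,
        h.four_ne i (by omega)]
      simp only [pow_succ (2 : ℚ) d, pow_add (2 : ℚ) i]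
      field
    · rw [lowerStep_two, h.two_top _ le_rfl, h.three_top _ le_rfl, h.four_eq _ rfl]
      simp only [pow_succ (2 : ℚ) d, pow_add (2 : ℚ) (4 * d), pow_mul' (2 : ℚ) 4 d]
      field
    · obtain rfl : i = 4 * d + 1 := by omega
      rw [lowerStep_two, h.two_top _ (by omega), h.three_top _ (by omega), h.four_ne _ (by omega)]
      simp only [pow_succ (2 : ℚ) d, pow_add (2 : ℚ) (4 * d + 1), pow_add (2 : ℚ) (4 * d),
        pow_mul' (2 : ℚ) 4 d]
      field
  two_top j hj := by
    obtain ⟨i, rfl⟩ : ∃ i, j = i + 2 := ⟨j - 2, by omega⟩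
    rw [lowerStep_two, h.two_top i (by omega), h.three_top i (by omega), h.four_ne i (by omega)]
    ring
  one_lt j hj := by
    rcases Nat.lt_or_ge j 1 with h4 | h4
    · exact lowerStep_of_lt h4
    obtain ⟨i, rfl⟩ : ∃ i, j = i + 1 := ⟨j - 1, by omega⟩
    rw [lowerStep_one, h.one_lt i (by omega), h.two_lt i (by omega), h.three_lt i (by omega),
      h.four_ne i (by omega)]
    ring
  one_one j hj := by
    obtain ⟨i, rfl⟩ : ∃ i, j = i + 1 := ⟨j - 1, by omega⟩
    rw [lowerStep_one, h.one_one i (by omega), h.two_lt i (by omega), h.three_lt i (by omega),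
      h.four_ne i (by omega)]
    ring
  one_mid j hj hj' := by
    obtain ⟨i, rfl⟩ : ∃ i, j = i + 1 := ⟨j - 1, by omega⟩
    rw [lowerStep_one, h.three_lt i (by omega), h.four_ne i (by omega)]
    rcases Nat.lt_or_ge i (2 * d) with hi | hi
    · rw [h.one_mid i (by omega) hi, h.two_lt i hi]
      simp only [pow_succ (2 : ℚ) d, pow_add (2 : ℚ) i]
      field
    · obtain rfl : i = 2 * d := by omega
      rw [h.one_two _ rfl, h.two_zero _ rfl]
      simp only [pow_succ (2 : ℚ) d, pow_add (2 : ℚ) (2 * d), pow_mul' (2 : ℚ) 2 d]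
      field
  one_two j hj := by
    obtain ⟨i, rfl⟩ : ∃ i, j = i + 1 := ⟨j - 1, by omega⟩
    obtain rfl : i = 2 * d + 1 := by omega
    rw [lowerStep_one, h.one_high _ (by omega) (by omega), h.two_one _ rfl,
      h.three_lt _ (by omega), h.four_ne _ (by omega)]
    simp only [pow_succ (2 : ℚ) d, pow_add (2 : ℚ) (2 * d), pow_mul' (2 : ℚ) 2 d]
    field
  one_high j hj hj' := by
    obtain ⟨i, rfl⟩ : ∃ i, j = i + 1 := ⟨j - 1, by omega⟩
    rw [lowerStep_one, h.four_ne i (by omega)]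
    rcases lt_trichotomy i (3 * d) with hi | rfl | hi
    · rw [h.one_high i (by omega) hi, h.two_mid i (by omega) hi, h.three_lt i hi]
      simp only [pow_succ (2 : ℚ) d, pow_add (2 : ℚ) i]
      field
    · rw [h.one_last _ le_rfl (by omega), h.two_three _ rfl, h.three_zero _ rfl]
      simp only [pow_succ (2 : ℚ) d, pow_add (2 : ℚ) (3 * d), pow_mul' (2 : ℚ) 3 d]
      field
    · obtain rfl : i = 3 * d + 1 := by omega
      rw [h.one_last _ (by omega) (by omega), h.two_high _ (by omega) (by omega),
        h.three_one _ rfl]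
      simp only [pow_succ (2 : ℚ) d, pow_add (2 : ℚ) (3 * d + 1), pow_add (2 : ℚ) (3 * d),
        pow_mul' (2 : ℚ) 3 d]
      field
  one_last j hj hj' := by
    obtain ⟨i, rfl⟩ : ∃ i, j = i + 1 := ⟨j - 1, by omega⟩
    rw [lowerStep_one]
    rcases lt_trichotomy i (4 * d) with hi | rfl | hi
    · rw [h.one_last i (by omega) hi, h.two_high i (by omega) hi, h.three_mid i (by omega) hi,
        h.four_ne i (by omega)]
      simp only [pow_succ (2 : ℚ) d, pow_add (2 : ℚ) i]
      field
    · rw [h.one_top _ le_rfl, h.two_top _ le_rfl, h.three_top _ le_rfl, h.four_eq _ rfl]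
      simp only [pow_succ (2 : ℚ) d, pow_add (2 : ℚ) (4 * d), pow_mul' (2 : ℚ) 4 d]
      field
    · rw [h.one_top _ hi.le, h.two_top _ hi.le, h.three_top _ hi.le, h.four_ne _ hi.ne']
      obtain rfl | rfl : i = 4 * d + 1 ∨ i = 4 * d + 2 := by omega
      all_goals
        simp only [pow_succ (2 : ℚ) d, pow_add (2 : ℚ) (4 * d + 1), pow_add (2 : ℚ) (4 * d + 2),
          pow_add (2 : ℚ) (4 * d), pow_mul' (2 : ℚ) 4 d]
        field
  one_top j hj := by
    obtain ⟨i, rfl⟩ : ∃ i, j = i + 1 := ⟨j - 1, by omega⟩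
    rw [lowerStep_one, h.one_top i (by omega), h.two_top i (by omega), h.three_top i (by omega),
      h.four_ne i (by omega)]
    ring
  nil_low j hj hj' := by
    rw [lowerStep_zero, h.three_lt j (by omega), h.four_ne j (by omega)]
    rcases lt_trichotomy j (2 * d) with hi | rfl | hi
    · rw [h.nil_low j (by omega) hi, h.one_mid j (by omega) hi, h.two_lt j hi]
      simp only [pow_succ (2 : ℚ) d]
      field
    · rw [h.nil_mid _ le_rfl (by omega), h.one_two _ rfl, h.two_zero _ rfl]
      simp only [pow_succ (2 : ℚ) d, pow_mul' (2 : ℚ) 2 d]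
      field
    · obtain rfl : j = 2 * d + 1 := by omega
      rw [h.nil_mid _ (by omega) (by omega), h.one_high _ (by omega) (by omega), h.two_one _ rfl]
      simp only [pow_succ (2 : ℚ) d, pow_add (2 : ℚ) (2 * d), pow_mul' (2 : ℚ) 2 d]
      field
  nil_mid j hj hj' := by
    rw [lowerStep_zero]
    rcases lt_trichotomy j (3 * d) with hi | rfl | hi
    · rw [h.nil_mid j (by omega) hi, h.one_high j (by omega) hi, h.two_mid j (by omega) hi,
        h.three_lt j hi, h.four_ne j (by omega)]
      simp only [pow_succ (2 : ℚ) d]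
      field
    · rw [h.nil_high _ (by omega) (by omega), h.one_last _ le_rfl (by omega), h.two_three _ rfl,
        h.three_zero _ rfl, h.four_ne _ (by omega)]
      simp only [pow_succ (2 : ℚ) d, pow_mul' (2 : ℚ) 3 d]
      field
    · obtain rfl | rfl : j = 3 * d + 1 ∨ j = 3 * d + 2 := by omega
      · rw [h.nil_high _ (by omega) (by omega), h.one_last _ (by omega) (by omega),
          h.two_high _ (by omega) (by omega), h.three_one _ rfl, h.four_ne _ (by omega)]
        simp only [pow_succ (2 : ℚ) d, pow_add (2 : ℚ) (3 * d), pow_mul' (2 : ℚ) 3 d]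
        field
      · rcases Nat.lt_or_ge (3 * d + 2) (4 * d) with h2 | h2
        · rw [h.nil_high _ (by omega) h2, h.one_last _ (by omega) h2,
            h.two_high _ (by omega) h2, h.three_mid _ le_rfl h2, h.four_ne _ (by omega)]
          simp only [pow_succ (2 : ℚ) d, pow_add (2 : ℚ) (3 * d), pow_mul' (2 : ℚ) 3 d]
          field
        -- Only for `d = 2` does `3 * d + 2` reach the top sum `4 * d`.
        · obtain rfl : d = 2 := by omega
          rw [h.nil_top _ h2, h.one_top _ h2, h.two_top _ h2, h.three_top _ h2, h.four_eq _ rfl]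
          norm_num
  nil_high j hj hj' := by
    rw [lowerStep_zero]
    rcases lt_trichotomy j (4 * d) with hi | rfl | hi
    · rw [h.nil_high j (by omega) hi, h.one_last j (by omega) hi, h.two_high j (by omega) hi,
        h.three_mid j (by omega) hi, h.four_ne j (by omega)]
      simp only [pow_succ (2 : ℚ) d]
      field
    · rw [h.nil_top _ le_rfl, h.one_top _ le_rfl, h.two_top _ le_rfl, h.three_top _ le_rfl,
        h.four_eq _ rfl]
      simp only [pow_succ (2 : ℚ) d, pow_mul' (2 : ℚ) 4 d]
      field
    · rw [h.nil_top _ hi.le, h.one_top _ hi.le, h.two_top _ hi.le, h.three_top _ hi.le,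
        h.four_ne _ hi.ne']
      obtain rfl | rfl | rfl : j = 4 * d + 1 ∨ j = 4 * d + 2 ∨ j = 4 * d + 3 := by omega
      all_goals
        simp only [pow_succ (2 : ℚ) d, pow_add (2 : ℚ) (4 * d), pow_mul' (2 : ℚ) 4 d]
        field
  nil_top j hj := by
    rw [lowerStep_zero, h.nil_top j (by omega), h.one_top j (by omega), h.two_top j (by omega),
      h.three_top j (by omega), h.four_ne j (by omega)]
    ring

/-- The base of the recursion for the shapes `(s, s + 1, s + 1)`. -/
def unequalBase (ρ j : ℕ) : ℚ :=
  if ρ ≤ j ∧ j - ρ ≤ 4 then unequalWeight (j - ρ) ρ * stepWeight (j - ρ) ρ else 0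

theorem isLowerClosed_unequalBase : IsLowerClosed 2 unequalBase where
  four_eq j hj := by
    subst hj
    norm_num [unequalBase, unequalWeight, stepWeight, qFact, Finset.prod_range_succ]
  four_ne j hj := by
    rcases Nat.lt_or_ge j 9 with h | h
    · interval_cases j <;>
        first
        | exact absurd rfl hj
        | norm_num [unequalBase, unequalWeight, stepWeight, qFact, Finset.prod_range_succ]
    · exact if_neg (by omega)
  three_lt j hj := by
    interval_cases j <;>
      norm_num [unequalBase, unequalWeight, stepWeight, qFact, Finset.prod_range_succ]
  three_zero j hj := by
    subst hj
    norm_num [unequalBase, unequalWeight, stepWeight, qFact, Finset.prod_range_succ]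
  three_one j hj := by
    subst hj
    norm_num [unequalBase, unequalWeight, stepWeight, qFact, Finset.prod_range_succ]
  three_mid j hj hj' := by omega
  three_top j hj := if_neg (by omega)
  two_lt j hj := by
    interval_cases j <;>
      norm_num [unequalBase, unequalWeight, stepWeight, qFact, Finset.prod_range_succ]
  two_zero j hj := by
    subst hj
    norm_num [unequalBase, unequalWeight, stepWeight, qFact, Finset.prod_range_succ]
  two_one j hj := by
    subst hj
    norm_num [unequalBase, unequalWeight, stepWeight, qFact, Finset.prod_range_succ]
  two_mid j hj hj' := by omega
  two_three j hj := by
    subst hj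
    norm_num [unequalBase, unequalWeight, stepWeight, qFact, Finset.prod_range_succ]
  two_high j hj hj' := by
    obtain rfl : j = 7 := by omega
    norm_num [unequalBase, unequalWeight, stepWeight, qFact, Finset.prod_range_succ]
  two_top j hj := if_neg (by omega)
  one_lt j hj := by
    interval_cases j <;>
      norm_num [unequalBase, unequalWeight, stepWeight, qFact, Finset.prod_range_succ]
  one_one j hj := by
    subst hj
    norm_num [unequalBase, unequalWeight, stepWeight, qFact, Finset.prod_range_succ]
  one_mid j hj hj' := by omega
  one_two j hj := by
    subst hj
    norm_num [unequalBase, unequalWeight, stepWeight, qFact, Finset.prod_range_succ]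
  one_high j hj hj' := by
    obtain rfl : j = 5 := by omega
    norm_num [unequalBase, unequalWeight, stepWeight, qFact, Finset.prod_range_succ]
  one_last j hj hj' := by
    obtain rfl | rfl : j = 6 ∨ j = 7 := by omega
    all_goals norm_num [unequalBase, unequalWeight, stepWeight, qFact, Finset.prod_range_succ]
  one_top j hj := if_neg (by omega)
  nil_low j hj hj' := by
    obtain rfl : j = 3 := by omega
    norm_num [unequalBase, unequalWeight, stepWeight, qFact, Finset.prod_range_succ]
  nil_mid j hj hj' := by
    obtain rfl | rfl : j = 4 ∨ j = 5 := by omega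
    all_goals norm_num [unequalBase, unequalWeight, stepWeight, qFact, Finset.prod_range_succ]
  nil_high j hj hj' := by
    obtain rfl | rfl | rfl : j = 5 ∨ j = 6 ∨ j = 7 := by omega
    all_goals norm_num [unequalBase, unequalWeight, stepWeight, qFact, Finset.prod_range_succ]
  nil_top j hj := if_neg (by omega)

theorem isLowerClosed_iterate (e : ℕ) : IsLowerClosed (e + 2) (lowerStep^[e] unequalBase) := by
  induction e with
  | zero => exact isLowerClosed_unequalBase
  | succ e ih =>
    rw [Function.iterate_succ_apply']
    exact ih.succ (by omega)

end

/-! ### From sequences to triples of persymmetric matrices. -/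

/-- The matrix with entries constant on the antidiagonals prescribed by a sequence. -/
def hankelMatrix (p q : ℕ) (a : ℕ → ZMod 2) : Matrix (Fin p) (Fin q) (ZMod 2) :=
  Matrix.of fun i j => a (i + j)

theorem isPersymmetric_hankelMatrix (p q : ℕ) (a : ℕ → ZMod 2) :
    IsPersymmetric (hankelMatrix p q a) := fun i r j t h => by
  simp only [hankelMatrix, Matrix.of_apply, h]

theorem IsPersymmetric.exists_eq {p q : ℕ} (hp : 0 < p) (hq : 0 < q)
    {A : Matrix (Fin p) (Fin q) (ZMod 2)} (hA : IsPersymmetric A) :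
    ∃ a, A = hankelMatrix p q a := by
  -- Antidiagonal `t` is read down the first column and then along the last row; the second `min`
  -- only keeps the index in range.
  refine ⟨fun t => A ⟨min t (p - 1), by omega⟩ ⟨min (t - (p - 1)) (q - 1), by omega⟩, ?_⟩
  ext i j
  refine hA _ _ _ _ ?_
  have := i.2
  have := j.2
  simp only
  omega

theorem eq_of_hankelMatrix_eq {p q : ℕ} {a b : ℕ → ZMod 2}
    (h : hankelMatrix p q a = hankelMatrix p q b) {t : ℕ} (hp : 0 < p) (hq : 0 < q)
    (ht : t + 1 < p + q) :
    a t = b t := by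
  have := congrFun (congrFun h ⟨min t (p - 1), by omega⟩) ⟨t - (p - 1), by omega⟩
  simp only [hankelMatrix, Matrix.of_apply] at this
  rwa [show min t (p - 1) + (t - (p - 1)) = t by omega] at this

theorem hankelMatrix_congr {p q : ℕ} {a b : ℕ → ZMod 2} (h : ∀ t, t + 1 < p + q → a t = b t) :
    hankelMatrix p q a = hankelMatrix p q b := by
  ext i j
  have := i.2
  have := j.2
  exact h _ (by omega)

theorem sum_fin_of_eq_zero {k N : ℕ} (h : k ≤ N) (f : Fin N → ZMod 2)
    (hf : ∀ j : Fin N, k ≤ (j : ℕ) → f j = 0) : ∑ j, f j = ∑ j : Fin k, f (Fin.castLE h j) := by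
  obtain ⟨r, rfl⟩ := Nat.exists_eq_add_of_le h
  rw [Fin.sum_univ_add, Finset.sum_eq_zero (f := fun i : Fin r => f (Fin.natAdd k i)), add_zero]
  · rfl
  · exact fun i _ => hf _ (by simp)

/-- The three stacked matrices attached to a sequence. -/
def stackOf (ε a d k : ℕ) (u : ℕ → Fin 3 → ZMod 2) : Matrix (Fin a) (Fin k) (ZMod 2) ×
    Matrix (Fin d) (Fin k) (ZMod 2) × Matrix (Fin d) (Fin k) (ZMod 2) :=
  (hankelMatrix a k fun t => u (t + ε) 0, hankelMatrix d k fun t => u t 1,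
    hankelMatrix d k fun t => u t 2)

section

variable {ε a d k m N : ℕ}

/-- For `ε = 1` row `0` of the first block merely determines the auxiliary entry. Restriction to the
first `k` coefficients is therefore injective, with image the kernel of the stack whose first block
starts at row `ε`; rank-nullity finishes. -/
theorem nullityAt_add_rank (hε : ε ≤ 1) (ha : a + ε = d) (hm : m + 1 = k + d) (hN : k ≤ N)
    (u : ℕ → Fin 3 → ZMod 2) : nullityAt ε N u m d +
      (Matrix.fromRows (stackOf ε a d k u).1 (Matrix.fromRows (stackOf ε a d k u).2.1
        (stackOf ε a d k u).2.2)).rank = k := by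
  set M := Matrix.fromRows (stackOf ε a d k u).1 (Matrix.fromRows (stackOf ε a d k u).2.1
        (stackOf ε a d k u).2.2) with hM
  have hker : ∀ q : Fin k → ZMod 2, q ∈ LinearMap.ker M.mulVecLin ↔
      (∀ i : Fin a, ∑ j : Fin k, u (i + j + ε) 0 * q j = 0) ∧
      (∀ i : Fin d, ∑ j : Fin k, u (i + j) 1 * q j = 0) ∧
      ∀ i : Fin d, ∑ j : Fin k, u (i + j) 2 * q j = 0 := by
    intro q
    rw [LinearMap.mem_ker, Matrix.mulVecLin_apply, hM, Matrix.fromRows_mulVec,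
      Matrix.fromRows_mulVec, funext_iff, Sum.forall, Sum.forall]
    rfl
  let f : KerSpace N →ₗ[ZMod 2] (Fin k → ZMod 2) :=
    LinearMap.funLeft (ZMod 2) (ZMod 2) (Fin.castLE hN) ∘ₗ LinearMap.fst _ _ _
  have hrow : ∀ v : KerSpace N, (∀ j : Fin N, m + 1 ≤ (j : ℕ) + d → v.1 j = 0) → ∀ i b,
      blockRow u i v b =
        ∑ j : Fin k, u (i + j) b * v.1 (Fin.castLE hN j) + if i = 0 then v.2 b else 0 := by
    intro v hv i b
    rw [blockRow, LinearMap.coe_mk, AddHom.coe_mk, sum_fin_of_eq_zero hN]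
    · rfl
    · intro j hj
      rw [hv j (by omega), mul_zero]
  have hbot : hankelKer ε N u m d ⊓ LinearMap.ker f = ⊥ := by
    rw [eq_bot_iff]
    rintro v ⟨⟨h1, h2, h3⟩, h4⟩
    have hp : ∀ j, v.1 (Fin.castLE hN j) = 0 := fun j => congrFun h4 j
    have hp' : v.1 = 0 := by
      ext j
      rcases Nat.lt_or_ge (j : ℕ) k with h | h
      · exact hp ⟨j, h⟩
      · exact h1 j (by omega)
    have hc : v.2 = 0 := by
      ext b
      rcases Nat.lt_or_ge (b : ℕ) ε with hb | hb
      · have := congrFun (h3 0 (by omega)) b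
        rw [hrow v h1, if_pos rfl] at this
        simpa [hp] using this
      · exact h2 b hb
    exact Prod.ext hp' hc
  have hmap : (hankelKer ε N u m d).map f = LinearMap.ker M.mulVecLin := by
    ext q
    rw [hker, Submodule.mem_map]
    constructor
    · rintro ⟨v, ⟨h1, h2, h3⟩, rfl⟩
      have hz : ∀ i < d, ∀ b : Fin 3, (i = 0 → ε ≤ (b : ℕ)) →
          ∑ j : Fin k, u (i + j) b * v.1 (Fin.castLE hN j) = 0 := by
        intro i hi b hb
        have := congrFun (h3 i hi) b
        rw [hrow v h1] at this
        split_ifs at this with h0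
        · rwa [h2 b (hb h0), add_zero] at this
        · rwa [add_zero] at this
      refine ⟨fun i => ?_, fun i => hz i i.2 1 fun _ => hε, fun i => hz i i.2 2 fun _ => ?_⟩
      · rw [← hz (i + ε) (by have := i.2; omega) 0 fun h => by simp; omega]
        exact Finset.sum_congr rfl fun j _ => by rw [add_right_comm]; rfl
      · exact hε.trans (by decide)
    · rintro ⟨h1, h2, h3⟩
      let v : KerSpace N := (fun j => if h : (j : ℕ) < k then q ⟨j, h⟩ else 0,
        fun b => if (b : ℕ) < ε then -∑ j : Fin k, u j b * q j else 0)
      have hv : ∀ j : Fin N, m + 1 ≤ (j : ℕ) + d → v.1 j = 0 := fun j hj =>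
        dif_neg (by omega)
      have hvq : ∀ j : Fin k, v.1 (Fin.castLE hN j) = q j := fun j => dif_pos j.2
      refine ⟨v, ⟨hv, fun b hb => if_neg (by omega), fun i hi => ?_⟩, funext hvq⟩
      ext b
      rw [hrow v hv]
      simp only [hvq]
      by_cases hb : i = 0 ∧ (b : ℕ) < ε
      · rw [hb.1, if_pos rfl]
        simp only [zero_add]
        change _ + (if (b : ℕ) < ε then -∑ j : Fin k, u j b * q j else 0) = 0
        rw [if_pos hb.2]
        exact add_neg_cancel _
      · have hsum : ∑ j : Fin k, u (i + j) b * q j = 0 := by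
          fin_cases b
          · obtain ⟨i, rfl⟩ : ∃ l, i = l + ε := ⟨i - ε, by
              simp only [not_and] at hb
              omega⟩
            rw [← h1 ⟨i, by omega⟩]
            exact Finset.sum_congr rfl fun j _ => by rw [add_right_comm]; rfl
          · exact h2 ⟨i, hi⟩
          · exact h3 ⟨i, hi⟩
        rw [hsum, zero_add]
        split_ifs with h0
        · exact if_neg fun h => hb ⟨h0, h⟩
        · rfl
  have h := finrank_map_add_finrank_inf_ker (hankelKer ε N u m d) f
  rw [hbot, hmap, finrank_bot, add_zero] at h
  have h' := LinearMap.finrank_range_add_finrank_ker M.mulVecLin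
  rw [Module.finrank_fin_fun] at h'
  rw [nullityAt, ← h, Matrix.rank, add_comm]
  exact h'

theorem persymCount_eq_zero {a b c k i : ℕ} (h : k < i) : persymCount a b c k i = 0 := by
  rw [persymCount, Set.ncard_eq_zero (Set.toFinite _), Set.eq_empty_iff_forall_notMem]
  rintro M ⟨-, -, -, hM⟩
  have := Matrix.rank_le_card_width (Matrix.fromRows M.1 (Matrix.fromRows M.2.1 M.2.2))
  rw [Fintype.card_fin] at this
  omega

-- The first `ε` terms of component `0` do not occur in the stacked matrix. They are free and
-- account for the factor `2 ^ ε`; all other terms correspond to antidiagonals.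
open Classical in
theorem two_pow_mul_persymCount (hε : ε ≤ 1) (ha : a + ε = d) (hm : m + 1 = k + d) (hN : k ≤ N)
    (ha0 : 0 < a) (hk0 : 0 < k) {i n : ℕ} (hin : i + n = k) :
    2 ^ ε * (persymCount a d d k i : ℚ) = ∑ u : Fin m → Fin 3 → ZMod 2,
      (if nullityAt ε N (seqOf u) m d = n then (1 : ℚ) else 0) := by
  rw [Finset.sum_boole, persymCount]
  have hc : 2 ^ ε = (Set.univ : Set (Fin ε → ZMod 2)).ncard := by
    rw [Set.ncard_univ, Nat.card_eq_fintype_card, Fintype.card_fun, ZMod.card, Fintype.card_fin]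
  have h : (Finset.univ.filter fun u : Fin m → Fin 3 → ZMod 2 =>
      nullityAt ε N (seqOf u) m d = n).card =
      {u : Fin m → Fin 3 → ZMod 2 | nullityAt ε N (seqOf u) m d = n}.ncard := by
    rw [Set.ncard_eq_toFinset_card']
    congr 1
    ext
    simp
  rw [h]
  norm_cast
  rw [hc, ← Set.ncard_prod]
  symm
  refine Set.ncard_congr (fun u _ => (fun t : Fin ε => seqOf u t 0, stackOf ε a d k (seqOf u)))
    ?_ ?_ ?_
  · intro u hu
    refine ⟨trivial, isPersymmetric_hankelMatrix a k fun t => seqOf u (t + ε) 0,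
      isPersymmetric_hankelMatrix d k fun t => seqOf u t 1,
      isPersymmetric_hankelMatrix d k fun t => seqOf u t 2, ?_⟩
    have := nullityAt_add_rank hε ha hm hN (seqOf u)
    rw [Set.mem_ofPred_eq] at hu
    simp only
    omega
  · intro u w _ _ huw
    rw [Prod.mk.injEq] at huw
    obtain ⟨h0, h1⟩ := huw
    simp only [stackOf, Prod.mk.injEq] at h1
    obtain ⟨h1, h2, h3⟩ := h1
    have hseq : ∀ t < m, ∀ b, seqOf u t b = seqOf w t b := by
      intro t ht b
      fin_cases b
      · rcases Nat.lt_or_ge t ε with h | h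
        · exact congrFun h0 ⟨t, h⟩
        · have := eq_of_hankelMatrix_eq h1 (t := t - ε) ha0 hk0 (by omega)
          simp only [Nat.sub_add_cancel h] at this
          exact this
      · exact eq_of_hankelMatrix_eq h2 (by omega) hk0 (by omega)
      · exact eq_of_hankelMatrix_eq h3 (by omega) hk0 (by omega)
    ext t b
    have := hseq t t.2 b
    simpa [seqOf] using this
  · rintro ⟨c, A, B, C⟩ ⟨-, hA, hB, hC, hr⟩
    obtain ⟨α, rfl⟩ := hA.exists_eq ha0 hk0
    obtain ⟨β, rfl⟩ := hB.exists_eq (by omega) hk0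
    obtain ⟨γ, rfl⟩ := hC.exists_eq (by omega) hk0
    let u : Fin m → Fin 3 → ZMod 2 := fun t =>
      ![if h : (t : ℕ) < ε then c ⟨t, h⟩ else α (t - ε), β t, γ t]
    have hu : ∀ t, t < m → seqOf u t = ![if h : t < ε then c ⟨t, h⟩ else α (t - ε), β t, γ t] :=
      fun t ht => dif_pos ht
    have hst : stackOf ε a d k (seqOf u) =
        (hankelMatrix a k α, hankelMatrix d k β, hankelMatrix d k γ) := by
      rw [stackOf]
      refine congrArg₂ Prod.mk (hankelMatrix_congr fun t ht => ?_) (congrArg₂ Prod.mk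
        (hankelMatrix_congr fun t ht => ?_) (hankelMatrix_congr fun t ht => ?_))
      · simp [hu (t + ε) (by omega)]
      · simp [hu t (by omega)]
      · simp [hu t (by omega)]
    refine ⟨u, ?_, Prod.ext (funext fun t => ?_) hst⟩
    · have := nullityAt_add_rank hε ha hm hN (seqOf u)
      rw [hst] at this
      simp only at this hr
      rw [Set.mem_ofPred_eq]
      omega
    · simp only
      rw [hu t (by have := t.2; omega)]
      simp

end

/-! ### Rank counts as sums over parts, and the reduction formulas. -/

section

variable {N m : ℕ}

/-- The base of the recursion for the shapes `(s, s, s)`. -/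
def equalBase (ρ j : ℕ) : ℚ := if j = ρ then equalWeight ρ else 0

theorem IsLowerSum.iterate {ε D : ℕ} {F : ℕ → ℕ → ℚ} (hε : ε ≤ 1) (hm : m < N)
    (hF : IsLowerSum ε N m D F) (e : ℕ) (he : D + e < N) :
    IsLowerSum ε N m (D + e) (lowerStep^[e] F) := by
  induction e with
  | zero => exact hF
  | succ e ih =>
    rw [Function.iterate_succ_apply']
    exact (ih (by omega)).succ hε hm he

theorem two_mul_persymCount {e k i n : ℕ} (hk : 0 < k) (h : i + n = k) :
    2 * (persymCount (e + 1) (e + 2) (e + 2) k i : ℚ) =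
      ∑ ρ ∈ Finset.range 5, lowerStep^[e] unequalBase ρ (i + e + 3) * upperSum ρ n := by
  have hm : k + e + 1 < 2 * k + 2 * e + 5 := by omega
  have h1 := two_pow_mul_persymCount (ε := 1) (N := 2 * k + 2 * e + 5) (m := k + e + 1) le_rfl
    (show e + 1 + 1 = e + 2 from rfl) rfl (by omega) (by omega) hk h
  rw [pow_one] at h1
  rw [h1, show e + 2 = 1 + e + 1 by omega]
  exact sum_nullityAt_eq isStartWeight_unequal le_rfl hm
    ((isLowerSum_one isStartWeight_unequal le_rfl hm (by omega)).iterate le_rfl hm e (by omega))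
    (by omega) (by omega)

theorem persymCount_eq_sum {e k i n : ℕ} (hk : 0 < k) (h : i + n = k) :
    (persymCount (e + 1) (e + 1) (e + 1) k i : ℚ) =
      ∑ ρ ∈ Finset.range 5, lowerStep^[e] equalBase ρ (i + e + 1) * upperSum ρ n := by
  have hm : k + e < 2 * k + 2 * e + 5 := by omega
  have h1 := two_pow_mul_persymCount (ε := 0) (N := 2 * k + 2 * e + 5) (m := k + e) zero_le_one
    (show e + 1 + 0 = e + 1 from rfl) rfl (by omega) (by omega) hk h
  rw [pow_zero, one_mul] at h1
  rw [h1, show e + 1 = 0 + e + 1 by omega]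
  exact sum_nullityAt_eq isStartWeight_equal zero_le_one hm
    ((isLowerSum_zero isStartWeight_equal zero_le_one hm).iterate zero_le_one hm e (by omega))
    (by omega) (by omega)

/-- The weights `F` and `G` agree up to the factor `c` at distance at most `l` from the top
degrees `4 * d` and `4 * d'`, and vanish above. -/
structure AgreeAtTop (c : ℚ) (l d d' : ℕ) (F G : ℕ → ℕ → ℚ) : Prop where
  left : ∀ ρ ≤ 4, ∀ j, 4 * d < j → F ρ j = 0
  right : ∀ ρ ≤ 4, ∀ j, 4 * d' < j → G ρ j = 0
  left_four : ∀ j, j ≠ 4 * d → F 4 j = 0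
  right_four : ∀ j, j ≠ 4 * d' → G 4 j = 0
  agree : ∀ ρ ≤ 4, ∀ i j, i + 4 * d' = j + 4 * d → 4 * d ≤ i + l → F ρ i = c * G ρ j

theorem lowerStep_eq_zero {d : ℕ} {F : ℕ → ℕ → ℚ} (h : ∀ ρ ≤ 4, ∀ j, 4 * d < j → F ρ j = 0)
    {ρ : ℕ} (hρ : ρ ≤ 4) {j : ℕ} (hj : 4 * (d + 1) < j) : lowerStep F ρ j = 0 := by
  rw [lowerStep, if_pos (by omega)]
  refine Finset.sum_eq_zero fun x hx => ?_
  rw [h x (Nat.lt_succ_iff.mp (Finset.mem_range.mp hx)) _ (by omega), zero_mul]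

theorem lowerStep_four_eq_zero {d : ℕ} {F : ℕ → ℕ → ℚ} (h : ∀ j, j ≠ 4 * d → F 4 j = 0)
    {j : ℕ} (hj : j ≠ 4 * (d + 1)) : lowerStep F 4 j = 0 := by
  rcases Nat.lt_or_ge j 4 with h4 | h4
  · exact lowerStep_of_lt h4
  · obtain ⟨i, rfl⟩ : ∃ i, j = i + 4 := ⟨j - 4, by omega⟩
    rw [lowerStep_four, h i (by omega), mul_zero]

/-- A new part `ρ ≤ 3` costs at least one unit of distance from the top, so the shorter segment is
within `l` of its own top. A new part `4` occurs only at the exact top. -/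
theorem AgreeAtTop.succ {c : ℚ} {l d d' : ℕ} {F G : ℕ → ℕ → ℚ} (h : AgreeAtTop c l d d' F G)
    (hd : l < 4 * d) (hd' : l < 4 * d') :
    AgreeAtTop c (l + 1) (d + 1) (d' + 1) (lowerStep F) (lowerStep G) where
  left ρ hρ j hj := lowerStep_eq_zero h.left hρ hj
  right ρ hρ j hj := lowerStep_eq_zero h.right hρ hj
  left_four j hj := lowerStep_four_eq_zero h.left_four hj
  right_four j hj := lowerStep_four_eq_zero h.right_four hj
  agree ρ hρ i j hij hi := by
    rcases hρ.eq_or_lt with rfl | hρ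
    · by_cases h0 : i = 4 * (d + 1)
      · obtain ⟨i, rfl⟩ : ∃ x, i = x + 4 := ⟨i - 4, by omega⟩
        obtain ⟨j, rfl⟩ : ∃ x, j = x + 4 := ⟨j - 4, by omega⟩
        rw [lowerStep_four, lowerStep_four, h.agree 4 le_rfl i j (by omega) (by omega)]
        ring
      · rw [lowerStep_four_eq_zero h.left_four h0, lowerStep_four_eq_zero h.right_four (by omega),
          mul_zero]
    · rw [lowerStep, lowerStep, if_pos (by omega), if_pos (by omega), Finset.mul_sum]
      refine Finset.sum_congr rfl fun x hx => ?_
      rw [h.agree x (Nat.lt_succ_iff.mp (Finset.mem_range.mp hx)) (i - ρ) (j - ρ) (by omega)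
        (by omega), mul_assoc]

theorem AgreeAtTop.iterate {c : ℚ} {l d d' : ℕ} {F G : ℕ → ℕ → ℚ} (h : AgreeAtTop c l d d' F G)
    (hd : l < 4 * d) (hd' : l < 4 * d') (e : ℕ) :
    AgreeAtTop c (l + e) (d + e) (d' + e) (lowerStep^[e] F) (lowerStep^[e] G) := by
  induction e with
  | zero => exact h
  | succ e ih =>
    rw [Function.iterate_succ_apply', Function.iterate_succ_apply']
    exact ih.succ (by omega) (by omega)

theorem equalBase_of_ne {ρ j : ℕ} (h : j ≠ ρ) : equalBase ρ j = 0 := if_neg h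

/-- Only the all-`4` segments count here, of weights `6615` and `6615 / 512`. -/
theorem agreeAtTop_unequalBase : AgreeAtTop 512 0 2 1 unequalBase equalBase where
  left ρ hρ j hj := if_neg (by omega)
  right ρ hρ j hj := equalBase_of_ne (by omega)
  left_four := isLowerClosed_unequalBase.four_ne
  right_four j hj := equalBase_of_ne hj
  agree ρ hρ i j hij hi := by
    rcases hρ.eq_or_lt with rfl | hρ
    · rcases Nat.lt_or_ge 8 i with h | h
      · rw [equalBase_of_ne (by omega), unequalBase, if_neg (by omega), mul_zero]
      · obtain rfl : i = 8 := by omega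
        obtain rfl : j = 4 := by omega
        norm_num [unequalBase, equalBase, unequalWeight, equalWeight, stepWeight, qFact]
    · rw [equalBase_of_ne (by omega), unequalBase, if_neg (by omega), mul_zero]

theorem agreeAtTop_equalBase :
    AgreeAtTop 4096 0 2 1 (lowerStep equalBase) equalBase where
  left ρ hρ j hj := lowerStep_eq_zero (d := 1) (fun ρ hρ j hj => equalBase_of_ne (by omega)) hρ hj
  right ρ hρ j hj := equalBase_of_ne (by omega)
  left_four j hj := lowerStep_four_eq_zero (d := 1) (fun j hj => equalBase_of_ne hj) hj
  right_four j hj := equalBase_of_ne hj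
  agree ρ hρ i j hij hi := by
    rcases hρ.eq_or_lt with rfl | hρ
    · obtain rfl : i = j + 4 := by omega
      rw [lowerStep_four]
    · rw [equalBase_of_ne (by omega), mul_zero, lowerStep, if_pos (by omega)]
      refine Finset.sum_eq_zero fun x hx => ?_
      have := Finset.mem_range.mp hx
      rw [equalBase_of_ne (by omega), zero_mul]

/-- Each extra step inserts one more part `4`, contributing `stepWeight 4 4 = 4096`. The distance
`l` from the top stays fixed while the range of agreement is at least `e`. -/
theorem iterate_equalBase_top (e j : ℕ) {ρ l i : ℕ} (hρ : ρ ≤ 4) (hl : l ≤ e)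
    (hi : i + l = 4 * (e + 1)) :
    lowerStep^[e + j] equalBase ρ (i + 4 * j) = 4096 ^ j * lowerStep^[e] equalBase ρ i := by
  induction j with
  | zero => rw [pow_zero, one_mul]; rfl
  | succ j ih =>
    have := (agreeAtTop_equalBase.iterate (by omega) (by omega) (e + j)).agree ρ hρ
      (i + 4 * (j + 1)) (i + 4 * j) (by omega) (by omega)
    rw [← add_assoc, Function.iterate_succ_apply, this, ih]
    ring

theorem persymCount_reduction {e j k : ℕ} (hk : 3 * j + 3 ≤ k) :
    persymCount (e + j + 1) (e + j + 2) (e + j + 2) k (2 * e + 3 * j + 5) =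
      16 ^ (2 + 3 * j) *
        persymCount (e + 1) (e + 1) (e + 1) (k - 2 - 3 * j) (2 * e + 3) := by
  rcases Nat.lt_or_ge k (2 * e + 3 * j + 5) with h | h
  · rw [persymCount_eq_zero h, persymCount_eq_zero (by omega), mul_zero]
  obtain ⟨n, rfl⟩ := Nat.exists_eq_add_of_le h
  rw [← Nat.cast_inj (R := ℚ)]
  push_cast
  rw [← mul_right_inj' (two_ne_zero (α := ℚ)), two_mul_persymCount (by omega) rfl,
    persymCount_eq_sum (n := n) (by omega) (by omega), Finset.mul_sum, Finset.mul_sum]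
  refine Finset.sum_congr rfl fun ρ hρ => ?_
  have hρ4 : ρ ≤ 4 := Nat.lt_succ_iff.mp (Finset.mem_range.mp hρ)
  -- Both indices lie at distance `e` from their tops. The constants combine as `512 * 4096 ^ j = 2
  -- * 16 ^ (2 + 3 * j)`, the `2` being the factor `2 ^ ε`.
  rw [(agreeAtTop_unequalBase.iterate (by omega) (by omega) (e + j)).agree ρ hρ4 _
    (2 * e + 3 + e + 1 + 4 * j) (by omega) (by omega),
    iterate_equalBase_top e j hρ4 (l := e) le_rfl (by omega), pow_add, pow_mul]
  norm_num
  ring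

end

/-! ### Assembly of the explicit formulas. -/

theorem exists_isLowerClosed {s : ℕ} (hs : 1 ≤ s) : ∃ G, IsLowerClosed (s + 1) G ∧
    (∀ i n, 0 < n → (persymCount s (s + 1) (s + 1) (i + n) i : ℚ) =
      (G 1 (i + s + 2) + G 2 (i + s + 2) * (4 * (2 * 2 ^ n - 1) / 3) +
        G 3 (i + s + 2) * (64 * (2 * 2 ^ n - 1) * (4 * 2 ^ n - 1) / 63) +
        G 4 (i + s + 2) *
          (4096 * (2 * 2 ^ n - 1) * (4 * 2 ^ n - 1) * (8 * 2 ^ n - 1) / 6615)) / 2) ∧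
    ∀ i, 0 < i → (persymCount s (s + 1) (s + 1) i i : ℚ) =
      lowerStep G 0 (i + s + 2) / 2 := by
  obtain ⟨e, rfl⟩ : ∃ e, s = e + 1 := ⟨s - 1, by omega⟩
  refine ⟨_, isLowerClosed_iterate e, fun i n hn => ?_, fun i hi => ?_⟩
  · rw [eq_div_iff two_ne_zero, mul_comm, two_mul_persymCount (by omega) rfl]
    simp only [Finset.sum_range_succ, Finset.sum_range_zero, upperSum, hn.ne', if_false]
    rw [show i + (e + 1) + 2 = i + e + 3 by omega]
    ring
  -- Full column rank means that no parts remain, which amounts to one further transfer step to the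
  -- part `0`. For smaller rank `G 0` drops out, because `upperSum 0 n = 0`.
  · rw [eq_div_iff two_ne_zero, mul_comm, two_mul_persymCount hi (add_zero i),
      lowerStep_zero, show i + (e + 1) + 2 = i + e + 3 by omega]
    simp only [Finset.sum_range_succ, Finset.sum_range_zero, upperSum, if_true]
    ring

set_option linter.unusedSimpArgs false

theorem theorem3p5 (s : ℕ) (hs : 1 ≤ s) :
    -- the number of rank `i` matrices with `k` columns
    (∀ k : ℕ, 1 ≤ k → persymCount s (s + 1) (s + 1) k 0 = 1) ∧
    (∀ i k : ℕ, 1 ≤ i → i + 1 ≤ s → i + 1 ≤ k →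
      (persymCount s (s + 1) (s + 1) k i : ℚ) =
        105 * 2 ^ (4 * (i : ℤ) - 6) - 21 * 2 ^ (3 * (i : ℤ) - 5)) ∧
    (∀ k : ℕ, s + 1 ≤ k →
      (persymCount s (s + 1) (s + 1) k s : ℚ) =
        2 ^ ((k : ℤ) + s - 1) - 2 ^ (2 * (s : ℤ)) + 105 * 2 ^ (4 * (s : ℤ) - 6)
          - 21 * 2 ^ (3 * (s : ℤ) - 5)) ∧
    (∀ k : ℕ, s + 2 ≤ k →
      (persymCount s (s + 1) (s + 1) k (s + 1) : ℚ) =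
        33 * 2 ^ ((k : ℤ) + s - 1)
          + (105 * 2 ^ (4 * (s : ℤ) - 2) - 21 * 2 ^ (3 * (s : ℤ) - 2)
            - 69 * 2 ^ (2 * (s : ℤ)))) ∧
    (∀ k : ℕ, 2 ≤ s → s + 3 ≤ k →
      (persymCount s (s + 1) (s + 1) k (s + 2) : ℚ) =
        630 * 2 ^ ((k : ℤ) + s - 1)
          + 21 * (5 * 2 ^ (4 * (s : ℤ) + 2) - 2 ^ (3 * (s : ℤ) + 1)
            - 65 * 2 ^ (2 * (s : ℤ) + 1))) ∧
    (∀ k : ℕ, 3 ≤ s → s + 4 ≤ k →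
      (persymCount s (s + 1) (s + 1) k (s + 3) : ℚ) =
        1365 * 2 ^ ((k : ℤ) + s + 2)
          + 21 * (5 * 2 ^ (4 * (s : ℤ) + 6) - 2 ^ (3 * (s : ℤ) + 4)
            - 285 * 2 ^ (2 * (s : ℤ) + 4))) ∧
    (∀ k : ℕ, 4 ≤ s → s + 5 ≤ k →
      (persymCount s (s + 1) (s + 1) k (s + 4) : ℚ) =
        2835 * 2 ^ ((k : ℤ) + s + 5)
          + 21 * (5 * 2 ^ (4 * (s : ℤ) + 10) - 2 ^ (3 * (s : ℤ) + 7)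
            - 595 * 2 ^ (2 * (s : ℤ) + 8))) ∧
    (∀ j k : ℕ, 2 ≤ j → j ≤ s → s + j + 1 ≤ k →
      (persymCount s (s + 1) (s + 1) k (s + j) : ℚ) =
        105 * (7 * 2 ^ ((j : ℤ) - 2) - 1) * 2 ^ ((k : ℤ) + s + 3 * j - 7)
          + 21 * (5 * 2 ^ (4 * (s : ℤ) + 4 * j - 6) - 2 ^ (3 * (s : ℤ) + 3 * j - 5)
            - 155 * 2 ^ (2 * (s : ℤ) + 5 * j - 10) + 25 * 2 ^ (2 * (s : ℤ) + 4 * j - 8))) ∧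
    (∀ k : ℕ, 2 * s + 2 ≤ k →
      (persymCount s (s + 1) (s + 1) k (2 * s + 1) : ℚ) =
        3 * 2 ^ (2 * (s : ℤ) - 1) * (2 ^ (2 * (k : ℤ)) - 2 ^ (4 * (s : ℤ) + 4))
          + (735 * 2 ^ (5 * (s : ℤ) - 5) - 393 * 2 ^ (4 * (s : ℤ) - 4))
            * (2 ^ (k : ℤ) - 2 ^ (2 * (s : ℤ) + 2))
          + 21 * (5 * 2 ^ (8 * (s : ℤ) - 2) + 2 ^ (6 * (s : ℤ) - 4)
            - 15 * 2 ^ (7 * (s : ℤ) - 5))) ∧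
    (∀ k : ℕ, 2 * s + 3 ≤ k →
      (persymCount s (s + 1) (s + 1) k (2 * s + 2) : ℚ) =
        53 * 2 ^ (2 * (s : ℤ) - 1) * (2 ^ (2 * (k : ℤ)) - 2 ^ (4 * (s : ℤ) + 6))
          + (735 * 2 ^ (5 * (s : ℤ) - 1) - 1629 * 2 ^ (4 * (s : ℤ) - 1))
            * (2 ^ (k : ℤ) - 2 ^ (2 * (s : ℤ) + 3))
          + 21 * (5 * 2 ^ (8 * (s : ℤ) + 2) + 3 * 2 ^ (6 * (s : ℤ))
            - 15 * 2 ^ (7 * (s : ℤ)))) ∧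
    (∀ j k : ℕ, j + 2 ≤ s → 2 * s + 4 + j ≤ k →
      (persymCount s (s + 1) (s + 1) k (2 * s + 3 + j) : ℚ) =
        105 * (2 ^ (2 * (k : ℤ) + 2 * s + 4 * j + 2) + 7 * 2 ^ ((k : ℤ) + 5 * s + 4 * j + 3)
            - 31 * 2 ^ ((k : ℤ) + 4 * s + 5 * j + 3))
          + 105 * (2 ^ (8 * (s : ℤ) + 4 * j + 6) - 31 * 2 ^ (7 * (s : ℤ) + 5 * j + 5)
            + 93 * 2 ^ (6 * (s : ℤ) + 6 * j + 5))) ∧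
    (∀ k : ℕ, 3 * s + 2 ≤ k →
      (persymCount s (s + 1) (s + 1) k (3 * s + 2) : ℚ) =
        2 ^ (3 * (k : ℤ) + 3 * s - 1) - 7 * 2 ^ (2 * (k : ℤ) + 6 * s - 2)
          + 7 * 2 ^ ((k : ℤ) + 9 * s - 2) - 2 ^ (12 * (s : ℤ) - 1)) ∧
    -- the number of rank `i` matrices with `i` columns
    (∀ i : ℕ, 1 ≤ i → i ≤ s + 1 →
      (persymCount s (s + 1) (s + 1) i i : ℚ) =
        2 ^ (3 * (s : ℤ) + 3 * i - 1) - 7 * 2 ^ (4 * (i : ℤ) - 6)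
          + 3 * 2 ^ (3 * (i : ℤ) - 5)) ∧
    (∀ j : ℕ, 2 ≤ j → j ≤ s + 3 →
      (persymCount s (s + 1) (s + 1) (s + j) (s + j) : ℚ) =
        2 ^ (6 * (s : ℤ) + 3 * j - 1) - 7 * 2 ^ (4 * (s : ℤ) + 4 * j - 6)
          + 3 * 2 ^ (3 * (s : ℤ) + 3 * j - 5) + 7 * 2 ^ (2 * (s : ℤ) + 5 * j - 10)
          - 5 * 2 ^ (2 * (s : ℤ) + 4 * j - 8)) ∧
    (persymCount s (s + 1) (s + 1) (2 * s + 1) (2 * s + 1) : ℚ) =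
        2 ^ (9 * (s : ℤ) + 2) + 7 * 2 ^ (7 * (s : ℤ) - 5) - 7 * 2 ^ (8 * (s : ℤ) - 2)
          + 7 * 2 ^ (6 * (s : ℤ) - 4) ∧
    (persymCount s (s + 1) (s + 1) (2 * s + 2) (2 * s + 2) : ℚ) =
        2 ^ (9 * (s : ℤ) + 5) + 7 * 2 ^ (7 * (s : ℤ)) - 7 * 2 ^ (8 * (s : ℤ) + 2)
          + 2 ^ (6 * (s : ℤ)) ∧
    (persymCount s (s + 1) (s + 1) (2 * s + 3) (2 * s + 3) : ℚ) =
        2 ^ (9 * (s : ℤ) + 8) + 7 * 2 ^ (7 * (s : ℤ) + 5) - 7 * 2 ^ (8 * (s : ℤ) + 6)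
          - 2 ^ (6 * (s : ℤ) + 5) ∧
    (∀ j : ℕ, j + 1 ≤ s →
      (persymCount s (s + 1) (s + 1) (2 * s + 3 + j) (2 * s + 3 + j) : ℚ) =
        2 ^ (9 * (s : ℤ) + 3 * j + 8) - 7 * 2 ^ (8 * (s : ℤ) + 4 * j + 6)
          + 7 * 2 ^ (7 * (s : ℤ) + 5 * j + 5) - 2 ^ (6 * (s : ℤ) + 6 * j + 5)) ∧
    -- the reduction formulas
    (∀ j k : ℕ, j ≤ 1 → 2 * j + 1 ≤ k →
      persymCount s (s + 1) (s + 1) k (2 * s + 2 + j) =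
        16 ^ (2 * j) *
          persymCount s (s + (1 - j)) (s + (1 - j)) (k - 2 * j) (2 * s + 2 - j)) ∧
    (∀ j k : ℕ, j + 1 ≤ s → 2 + 3 * j + 1 ≤ k →
      persymCount s (s + 1) (s + 1) k (2 * s + 3 + j) =
        16 ^ (2 + 3 * j) *
          persymCount (s - j) (s - j) (s - j) (k - 2 - 3 * j) (2 * (s - j) + 1)) := by
  obtain ⟨G, hG, hpos, hfull⟩ := exists_isLowerClosed hs
  have hG' := hG.succ (by omega)
  have h2 : (2 : ℚ) ≠ 0 := two_ne_zero
  have hmid : ∀ j k : ℕ, 2 ≤ j → j ≤ s → s + j + 1 ≤ k →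
      (persymCount s (s + 1) (s + 1) k (s + j) : ℚ) =
        105 * (7 * 2 ^ ((j : ℤ) - 2) - 1) * 2 ^ ((k : ℤ) + s + 3 * j - 7)
          + 21 * (5 * 2 ^ (4 * (s : ℤ) + 4 * j - 6) - 2 ^ (3 * (s : ℤ) + 3 * j - 5)
            - 155 * 2 ^ (2 * (s : ℤ) + 5 * j - 10) + 25 * 2 ^ (2 * (s : ℤ) + 4 * j - 8)) := by
    intro j k hj hjs hk
    obtain ⟨n, rfl⟩ := Nat.exists_eq_add_of_le (show s + j ≤ k by omega)
    rw [hpos _ n (by omega), hG.one_high _ (by omega) (by omega),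
      hG.two_mid _ (by omega) (by omega), hG.three_lt _ (by omega), hG.four_ne _ (by omega)]
    simp only [Nat.cast_add, Nat.cast_mul, Nat.cast_one, Nat.cast_ofNat, zpow_sub₀ h2,
      zpow_add₀ h2, zpow_mul' (2 : ℚ), zpow_natCast, zpow_ofNat, zpow_one, pow_add, pow_mul']
    field
  refine ⟨?_, ?_, ?_, ?_, ?_, ?_, ?_, hmid, ?_, ?_, ?_, ?_, ?_, ?_, ?_, ?_, ?_, ?_, ?_, ?_⟩
  · intro k hk
    have h := hpos 0 k (by omega)
    rw [hG.one_one _ (by omega), hG.two_lt _ (by omega), hG.three_lt _ (by omega),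
      hG.four_ne _ (by omega), zero_add] at h
    have h' : (persymCount s (s + 1) (s + 1) k 0 : ℚ) = 1 := h.trans (by norm_num)
    exact_mod_cast h'
  · intro i k hi his hk
    obtain ⟨n, rfl⟩ := Nat.exists_eq_add_of_le (show i ≤ k by omega)
    rw [hpos _ n (by omega), hG.one_mid _ (by omega) (by omega), hG.two_lt _ (by omega),
      hG.three_lt _ (by omega), hG.four_ne _ (by omega)]
    simp only [Nat.cast_add, Nat.cast_mul, Nat.cast_one, Nat.cast_ofNat, zpow_sub₀ h2,
      zpow_add₀ h2, zpow_mul' (2 : ℚ), zpow_natCast, zpow_ofNat, zpow_one, pow_add, pow_mul']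
    field
  · intro k hk
    obtain ⟨n, rfl⟩ := Nat.exists_eq_add_of_le (show s ≤ k by omega)
    rw [hpos _ n (by omega), hG.one_two _ (by omega), hG.two_zero _ (by omega),
      hG.three_lt _ (by omega), hG.four_ne _ (by omega)]
    simp only [Nat.cast_add, Nat.cast_mul, Nat.cast_one, Nat.cast_ofNat, zpow_sub₀ h2,
      zpow_add₀ h2, zpow_mul' (2 : ℚ), zpow_natCast, zpow_ofNat, zpow_one, pow_add, pow_mul']
    field
  · intro k hk
    obtain ⟨n, rfl⟩ := Nat.exists_eq_add_of_le (show s + 1 ≤ k by omega)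
    rw [hpos _ n (by omega), hG.one_high _ (by omega) (by omega), hG.two_one _ (by omega),
      hG.three_lt _ (by omega), hG.four_ne _ (by omega)]
    simp only [Nat.cast_add, Nat.cast_mul, Nat.cast_one, Nat.cast_ofNat, zpow_sub₀ h2,
      zpow_add₀ h2, zpow_mul' (2 : ℚ), zpow_natCast, zpow_ofNat, zpow_one, pow_add, pow_mul']
    field
  · intro k hs' hk
    rw [hmid 2 k (by omega) hs' (by omega)]
    simp only [Nat.cast_add, Nat.cast_mul, Nat.cast_one, Nat.cast_ofNat, zpow_sub₀ h2,
      zpow_add₀ h2, zpow_mul' (2 : ℚ), zpow_natCast, zpow_ofNat, zpow_one, pow_add, pow_mul']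
    field
  · intro k hs' hk
    rw [hmid 3 k (by omega) hs' (by omega)]
    simp only [Nat.cast_add, Nat.cast_mul, Nat.cast_one, Nat.cast_ofNat, zpow_sub₀ h2,
      zpow_add₀ h2, zpow_mul' (2 : ℚ), zpow_natCast, zpow_ofNat, zpow_one, pow_add, pow_mul']
    field
  · intro k hs' hk
    rw [hmid 4 k (by omega) hs' (by omega)]
    simp only [Nat.cast_add, Nat.cast_mul, Nat.cast_one, Nat.cast_ofNat, zpow_sub₀ h2,
      zpow_add₀ h2, zpow_mul' (2 : ℚ), zpow_natCast, zpow_ofNat, zpow_one, pow_add, pow_mul']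
    field
  · intro k hk
    obtain ⟨n, rfl⟩ := Nat.exists_eq_add_of_le (show 2 * s + 1 ≤ k by omega)
    rw [hpos _ n (by omega), hG.one_last _ (by omega) (by omega), hG.two_three _ (by omega),
      hG.three_zero _ (by omega), hG.four_ne _ (by omega)]
    simp only [Nat.cast_add, Nat.cast_mul, Nat.cast_one, Nat.cast_ofNat, zpow_sub₀ h2,
      zpow_add₀ h2, zpow_mul' (2 : ℚ), zpow_natCast, zpow_ofNat, zpow_one, pow_add, pow_mul']
    field
  · intro k hk
    obtain ⟨n, rfl⟩ := Nat.exists_eq_add_of_le (show 2 * s + 2 ≤ k by omega)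
    rw [hpos _ n (by omega), hG.one_last _ (by omega) (by omega),
      hG.two_high _ (by omega) (by omega), hG.three_one _ (by omega), hG.four_ne _ (by omega)]
    simp only [Nat.cast_add, Nat.cast_mul, Nat.cast_one, Nat.cast_ofNat, zpow_sub₀ h2,
      zpow_add₀ h2, zpow_mul' (2 : ℚ), zpow_natCast, zpow_ofNat, zpow_one, pow_add, pow_mul']
    field
  · intro j k hj hk
    obtain ⟨n, rfl⟩ := Nat.exists_eq_add_of_le (show 2 * s + 3 + j ≤ k by omega)
    rw [hpos _ n (by omega), hG.one_last _ (by omega) (by omega),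
      hG.two_high _ (by omega) (by omega), hG.three_mid _ (by omega) (by omega),
      hG.four_ne _ (by omega)]
    simp only [Nat.cast_add, Nat.cast_mul, Nat.cast_one, Nat.cast_ofNat, zpow_sub₀ h2,
      zpow_add₀ h2, zpow_mul' (2 : ℚ), zpow_natCast, zpow_ofNat, zpow_one, pow_add, pow_mul']
    field
  · intro k hk
    -- At `k = 3 * s + 2` the rank equals the number of columns, so the full-rank formula is needed
    -- there.
    rcases hk.eq_or_lt with rfl | hk
    · rw [hfull _ (by omega), hG'.nil_high _ (by omega) (by omega)]
      simp only [Nat.cast_add, Nat.cast_mul, Nat.cast_one, Nat.cast_ofNat, zpow_sub₀ h2,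
        zpow_add₀ h2, zpow_mul' (2 : ℚ), zpow_natCast, zpow_ofNat, zpow_one, pow_add, pow_mul']
      field
    · obtain ⟨n, rfl⟩ := Nat.exists_eq_add_of_le hk.le
      rw [hpos _ n (by omega), hG.one_top _ (by omega), hG.two_top _ (by omega),
        hG.three_top _ (by omega), hG.four_eq _ (by omega)]
      simp only [Nat.cast_add, Nat.cast_mul, Nat.cast_one, Nat.cast_ofNat, zpow_sub₀ h2,
        zpow_add₀ h2, zpow_mul' (2 : ℚ), zpow_natCast, zpow_ofNat, zpow_one, pow_add, pow_mul']
      field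
  · intro i hi his
    rw [hfull _ (by omega), hG'.nil_low _ (by omega) (by omega)]
    simp only [Nat.cast_add, Nat.cast_mul, Nat.cast_one, Nat.cast_ofNat, zpow_sub₀ h2,
      zpow_add₀ h2, zpow_mul' (2 : ℚ), zpow_natCast, zpow_ofNat, zpow_one, pow_add, pow_mul']
    field
  · intro j hj hjs
    rw [hfull _ (by omega), hG'.nil_mid _ (by omega) (by omega)]
    simp only [Nat.cast_add, Nat.cast_mul, Nat.cast_one, Nat.cast_ofNat, zpow_sub₀ h2,
      zpow_add₀ h2, zpow_mul' (2 : ℚ), zpow_natCast, zpow_ofNat, zpow_one, pow_add, pow_mul']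
    field
  · rw [hfull _ (by omega), hG'.nil_mid _ (by omega) (by omega)]
    simp only [Nat.cast_add, Nat.cast_mul, Nat.cast_one, Nat.cast_ofNat, zpow_sub₀ h2,
      zpow_add₀ h2, zpow_mul' (2 : ℚ), zpow_natCast, zpow_ofNat, zpow_one, pow_add, pow_mul']
    field
  · rw [hfull _ (by omega), hG'.nil_mid _ (by omega) (by omega)]
    simp only [Nat.cast_add, Nat.cast_mul, Nat.cast_one, Nat.cast_ofNat, zpow_sub₀ h2,
      zpow_add₀ h2, zpow_mul' (2 : ℚ), zpow_natCast, zpow_ofNat, zpow_one, pow_add, pow_mul']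
    field
  · rw [hfull _ (by omega), hG'.nil_mid _ (by omega) (by omega)]
    simp only [Nat.cast_add, Nat.cast_mul, Nat.cast_one, Nat.cast_ofNat, zpow_sub₀ h2,
      zpow_add₀ h2, zpow_mul' (2 : ℚ), zpow_natCast, zpow_ofNat, zpow_one, pow_add, pow_mul']
    field
  · intro j hj
    -- For `j = 0` the index is one below three times the length `s + 2`. There the middle and high
    -- formulas agree, which is why `nil_high` starts one step early.
    rw [hfull _ (by omega), hG'.nil_high _ (by omega) (by omega)]
    simp only [Nat.cast_add, Nat.cast_mul, Nat.cast_one, Nat.cast_ofNat, zpow_sub₀ h2,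
      zpow_add₀ h2, zpow_mul' (2 : ℚ), zpow_natCast, zpow_ofNat, zpow_one, pow_add, pow_mul']
    field
  · intro j k hj hk
    obtain ⟨e, rfl⟩ : ∃ e, s = e + 1 := ⟨s - 1, by omega⟩
    obtain rfl | rfl : j = 0 ∨ j = 1 := by omega
    · simp
    · have h := persymCount_reduction (e := e) (j := 0) (k := k) (by omega)
      simpa [show 2 * (e + 1) + 2 + 1 = 2 * e + 5 by omega,
        show 2 * (e + 1) + 2 - 1 = 2 * e + 3 by omega] using h
  · intro j k hj hk
    obtain ⟨e, rfl⟩ : ∃ e, s = e + j + 1 := ⟨s - j - 1, by omega⟩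
    have h := persymCount_reduction (e := e) (j := j) (k := k) (by omega)
    rw [show 2 * (e + j + 1) + 3 + j = 2 * e + 3 * j + 5 by omega,
      show e + j + 1 - j = e + 1 by omega]
    exact h
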